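/- Let $n\ge 5$, let $\mathbb S^{n-1}=\{x\in\mathbb R^n:|x|=1\}$ be the Euclidean unit sphere and let $\sigma=\sigma_{n-1}$ be the uniform probability measure on it. For a $C^2$-smooth function $f:\mathbb S^{n-1}\to\mathbb R$ and $\theta\in\mathbb S^{n-1}$, the spherical gradient $\nabla_S f(\theta)$ is the shortest vector $w\in\mathbb R^n$ such that $$f(\theta')=f(\theta)+\langle w,\theta'-\theta\rangle+o(|\theta'-\theta|),\qquad \theta'\to\theta,\ \theta'\in\mathbb S^{n-1},$$ and the spherical Hessian $f''_S(\theta)$ is the symmetric $n\times n$ matrix $B$ of smallest Hilbert–Schmidt norm $\|B\|_{HS}=(\sum_{i,j}b_{ij}^2)^{1/2}$ such that $$f(\theta')-f(\theta)=\langle\nabla_S f(\theta),\theta'-\theta\rangle+\tfrac12\langle B(\theta'-\theta),\theta'-\theta\rangle+o(|\theta'-\theta|^2),\qquad \theta'\to\theta,\ \theta'\in\mathbb S^{n-1}.$$ For $1\le p\le\infty$ put $$\|\nabla_S f\|_p=\Big(\int|\nabla_S f|^p\,d\sigma\Big)^{1/p},\qquad \|f''_S\|_p=\Big(\int\|f''_S\|_{HS}^p\,d\sigma\Big)^{1/p},$$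 with the essential supremum when $p=\infty$. Let $p,q\in[1,\infty]$ with $\frac1p+\frac1q=1$, and let $f,g$ be $C^2$-smooth functions on $\mathbb S^{n-1}$ which are orthogonal to all linear functions in $L^2(\sigma)$, that is, $\int f(\theta)\langle v,\theta\rangle\,d\sigma(\theta)=\int g(\theta)\langle v,\theta\rangle\,d\sigma(\theta)=0$ for all $v\in\mathbb R^n$. Then $$|\mathrm{cov}_\sigma(f,g)|\le\frac{1}{(n-2)(n-4)}\big(\|f''_S\|_p+2\|\nabla_S f\|_p\big)\big(\|g''_S\|_q+2\|\nabla_S g\|_q\big),$$ where $\mathrm{cov}_\sigma(f,g)=\int fg\,d\sigma-\int f\,d\sigma\int g\,d\sigma$. -/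

import Mathlib

open MeasureTheory ProbabilityTheory Topology Asymptotics Matrix
open scoped ENNReal Manifold ContDiff InnerProductSpace

namespace SphereCov

/-- The Euclidean space `ℝⁿ`. -/
abbrev Space (n : ℕ) : Type := EuclideanSpace ℝ (Fin n)

/-- The unit sphere `𝕊ⁿ⁻¹` of `ℝⁿ`. -/
abbrev Sphere (n : ℕ) : Type := Metric.sphere (0 : Space n) 1

/-- The uniform distribution `σₙ₋₁` on the sphere: the surface measure, normalized to mass one. -/
noncomputable def sigma (n : ℕ) : Measure (Sphere n) :=
  ((volume : Measure (Space n)).toSphere Set.univ)⁻¹ • (volume : Measure (Space n)).toSphere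

/-- `f` is `C²`-smooth on the manifold `𝕊ⁿ⁻¹`. The `Fact` only tells Mathlib that `𝕊ⁿ⁻¹` has
dimension `n - 1`; it holds for every `n ≥ 1`. -/
def IsC2 {n : ℕ} (f : Sphere n → ℝ) : Prop :=
  ∀ [Fact (Module.finrank ℝ (Space n) = n - 1 + 1)], ContMDiff (𝓡 (n - 1)) 𝓘(ℝ, ℝ) 2 f

/-- `f` is orthogonal in `L²(σₙ₋₁)` to (the restrictions of) all linear functions. -/
def OrthogonalToLinear {n : ℕ} (f : Sphere n → ℝ) : Prop :=
  ∀ l : Space n →ₗ[ℝ] ℝ, ∫ θ, f θ * l θ ∂(sigma n) = 0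

/-- `f(θ') = f(θ) + ⟨w, θ' - θ⟩ + o(|θ' - θ|)` as `θ' → θ` on the sphere. -/
def HasTaylorOne {n : ℕ} (f : Sphere n → ℝ) (θ : Sphere n) (w : Space n) : Prop :=
  (fun θ' : Sphere n => f θ' - f θ - ⟪w, (θ' : Space n) - θ⟫_ℝ)
    =o[𝓝 θ] fun θ' : Sphere n => ‖(θ' : Space n) - θ‖

/-- `w` is the shortest vector with the first order Taylor expansion of `f` at `θ`. -/
def IsSphericalGradient {n : ℕ} (f : Sphere n → ℝ) (θ : Sphere n) (w : Space n) : Prop :=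
  HasTaylorOne f θ w ∧ ∀ w' : Space n, HasTaylorOne f θ w' → ‖w‖ ≤ ‖w'‖

open Classical in
/-- The spherical gradient `∇_S f(θ)` (zero where `f` has no first order expansion). -/
noncomputable def sphericalGradient {n : ℕ} (f : Sphere n → ℝ) (θ : Sphere n) : Space n :=
  if h : ∃ w, IsSphericalGradient f θ w then h.choose else 0

/-- The Hilbert-Schmidt norm of a real square matrix. -/
noncomputable def hsNorm {n : ℕ} (A : Matrix (Fin n) (Fin n) ℝ) : ℝ :=
  √(∑ i, ∑ j, A i j ^ 2)

/-- `f(θ') - f(θ) = ⟨∇_S f(θ), θ' - θ⟩ + ½ ⟨B (θ' - θ), θ' - θ⟩ + o(|θ' - θ|²)` as `θ' → θ` on the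
sphere. -/
def HasTaylorTwo {n : ℕ} (f : Sphere n → ℝ) (θ : Sphere n) (B : Matrix (Fin n) (Fin n) ℝ) : Prop :=
  (fun θ' : Sphere n => f θ' - f θ - ⟪sphericalGradient f θ, (θ' : Space n) - θ⟫_ℝ
      - 1 / 2 * ((B *ᵥ ((θ' : Space n) - θ).ofLp) ⬝ᵥ ((θ' : Space n) - θ).ofLp))
    =o[𝓝 θ] fun θ' : Sphere n => ‖(θ' : Space n) - θ‖ ^ 2

/-- `B` is the symmetric matrix of smallest Hilbert-Schmidt norm with the second order Taylor
expansion of `f` at `θ`. -/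
def IsSphericalHessian {n : ℕ} (f : Sphere n → ℝ) (θ : Sphere n)
    (B : Matrix (Fin n) (Fin n) ℝ) : Prop :=
  (B.IsSymm ∧ HasTaylorTwo f θ B) ∧
    ∀ B' : Matrix (Fin n) (Fin n) ℝ, B'.IsSymm → HasTaylorTwo f θ B' → hsNorm B ≤ hsNorm B'

open Classical in
/-- The spherical Hessian `f''_S(θ)` (zero where `f` has no second order expansion). -/
noncomputable def sphericalHessian {n : ℕ} (f : Sphere n → ℝ) (θ : Sphere n) :
    Matrix (Fin n) (Fin n) ℝ :=
  if h : ∃ B, IsSphericalHessian f θ B then h.choose else 0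

/-- `‖∇_S f‖_p = (∫ |∇_S f|^p dσₙ₋₁)^{1/p}` (essential supremum for `p = ∞`). -/
noncomputable def gradNorm {n : ℕ} (f : Sphere n → ℝ) (p : ℝ≥0∞) : ℝ :=
  (eLpNorm (fun θ => sphericalGradient f θ) p (sigma n)).toReal

/-- `‖f''_S‖_p = (∫ ‖f''_S‖_HS^p dσₙ₋₁)^{1/p}` (essential supremum for `p = ∞`). -/
noncomputable def hessNorm {n : ℕ} (f : Sphere n → ℝ) (p : ℝ≥0∞) : ℝ :=
  (eLpNorm (fun θ => hsNorm (sphericalHessian f θ)) p (sigma n)).toReal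

end SphereCov

/-! The inequality comes from applying Gaussian interpolation twice to the extensions `F(x) =
f(x/|x|)` and `G(x) = g(x/|x|)`, homogeneous of degree zero. Let `X`, `Z` be independent standard
Gaussian vectors and `Y = cos s X + sin s Z`. As `X/|X|` is uniform on the sphere, the covariance of
`f` and `g` is that of `F(X)` and `G(X)`.

Integration by parts gives `d/ds 𝔼 F(X) G(Y) = -sin s ∑ᵢ 𝔼 ∂ᵢF(X) ∂ᵢG(Y)` (`hasDerivAt_cor`). The
correlation at `s = 0` is `𝔼 FG` and at `s = π/2` it is `𝔼 F 𝔼 G`. Since `sin` has integral one over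
`[0, π/2]`, the covariance is at most the supremum over `s` of `|∑ᵢ 𝔼 ∂ᵢF(X) ∂ᵢG(Y)|`
(`abs_sum_cor_sub_le`). Orthogonality to linear functions says exactly that the `∂ᵢF` have mean zero
(`integral_pderiv_cut_eq_zero`), so the same argument applied to the gradients passes to second
derivatives and bounds the covariance by `sup 𝔼 ‖F''(X)‖ ‖G''(Y)‖` in Hilbert-Schmidt norm.

The second derivatives are homogeneous of degree `-2`, so this expectation is an integral of
functions of the directions of `X` and `Y` against the weight `|X|⁻² |Y|⁻²`. Under the weighted law
both directions are still uniform up to the total mass, so Hölder's inequality gives the product of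
the `L^p` and `L^q` norms times that mass (`lintegral_dir_mul_dir_le`). By Cauchy-Schwarz the mass
is at most `𝔼 |X|⁻⁴ = 1/((n-2)(n-4))`.

On the sphere the Euclidean Hessian of `F` differs from the spherical one by two rank-one matrices
of norm `|∇_S f|`, whence the terms `2‖∇_S f‖` (`hsNorm_hessMat_le`). Since `F` is singular at the
origin, the interpolation is run for `F` cut off in a ball of radius `1/R`; the error vanishes as `R
→ ∞` because `|x|⁻⁴` is integrable for `n ≥ 5`. -/

namespace SphereCov

/-! ### The standard Gaussian measure -/

/-- The density of the standard Gaussian measure on `ℝⁿ`. -/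
noncomputable def gaussDensity (n : ℕ) (x : Space n) : ℝ :=
  (∫ y : Space n, Real.exp (-(1 / 2) * ‖y‖ ^ 2))⁻¹ * Real.exp (-(1 / 2) * ‖x‖ ^ 2)

/-- The standard Gaussian measure on `ℝⁿ`. -/
noncomputable def gauss (n : ℕ) : Measure (Space n) :=
  volume.withDensity fun x => ENNReal.ofReal (gaussDensity n x)

lemma integral_exp_norm_sq_pos (n : ℕ) :
    0 < ∫ y : Space n, Real.exp (-(1 / 2) * ‖y‖ ^ 2) := by
  rw [GaussianFourier.integral_rexp_neg_mul_sq_norm (by norm_num)]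
  positivity

lemma integrable_exp_norm_sq (n : ℕ) :
    Integrable fun y : Space n => Real.exp (-(1 / 2) * ‖y‖ ^ 2) := by
  -- A nonintegrable function has Bochner integral zero, contradicting positivity.
  by_contra h
  exact (integral_exp_norm_sq_pos n).ne' (integral_undef h)

lemma gaussDensity_pos (n : ℕ) (x : Space n) : 0 < gaussDensity n x :=
  mul_pos (inv_pos.2 (integral_exp_norm_sq_pos n)) (Real.exp_pos _)

@[fun_prop]
lemma contDiff_gaussDensity (n : ℕ) : ContDiff ℝ ∞ (gaussDensity n) := by
  unfold gaussDensity
  exact contDiff_const.mul (Real.contDiff_exp.comp (contDiff_const.mul (contDiff_norm_sq ℝ)))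

@[fun_prop]
lemma continuous_gaussDensity (n : ℕ) : Continuous (gaussDensity n) :=
  (contDiff_gaussDensity n).continuous

lemma integrable_gaussDensity (n : ℕ) : Integrable (gaussDensity n) :=
  (integrable_exp_norm_sq n).const_mul _

lemma integral_gaussDensity (n : ℕ) : ∫ x, gaussDensity n x = 1 := by
  unfold gaussDensity
  rw [integral_const_mul, inv_mul_cancel₀ (integral_exp_norm_sq_pos n).ne']

instance (n : ℕ) : IsProbabilityMeasure (gauss n) := by
  constructor
  rw [gauss, withDensity_apply _ .univ, Measure.restrict_univ,
    ← ofReal_integral_eq_lintegral_ofReal (integrable_gaussDensity n)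
      (.of_forall fun x => (gaussDensity_pos n x).le), integral_gaussDensity, ENNReal.ofReal_one]

lemma integral_gauss (n : ℕ) (h : Space n → ℝ) :
    ∫ x, h x ∂(gauss n) = ∫ x, gaussDensity n x * h x := by
  rw [gauss, integral_withDensity_eq_integral_toReal_smul (by fun_prop) (by simp)]
  simp [ENNReal.toReal_ofReal (gaussDensity_pos n _).le]

lemma integrable_gauss_iff (n : ℕ) (h : Space n → ℝ) :
    Integrable h (gauss n) ↔ Integrable fun x => gaussDensity n x * h x := by
  rw [gauss, integrable_withDensity_iff_integrable_smul' (by fun_prop) (by simp)]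
  simp [ENNReal.toReal_ofReal (gaussDensity_pos n _).le]

lemma lintegral_gauss (n : ℕ) (h : Space n → ℝ≥0∞) :
    ∫⁻ x, h x ∂(gauss n) = ∫⁻ x, ENNReal.ofReal (gaussDensity n x) * h x := by
  rw [gauss, lintegral_withDensity_eq_lintegral_mul_non_measurable₀ _ (by fun_prop) (by simp)]
  rfl

lemma ae_ne_zero_gauss (n : ℕ) [NeZero n] : ∀ᵐ x ∂(gauss n), x ≠ 0 := by
  refine (withDensity_absolutelyContinuous _ _).ae_le ?_
  exact Measure.ae_ne volume 0

/-- The Gaussian density as a function of the norm. -/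
lemma gaussDensity_eq_of_norm_eq {n : ℕ} {x y : Space n} (h : ‖x‖ = ‖y‖) :
    gaussDensity n x = gaussDensity n y := by
  simp [gaussDensity, h]

/-! ### Polar coordinates -/

/-- The direction of a vector, with an arbitrary value at zero. -/
noncomputable def dir {n : ℕ} [NeZero n] (x : Space n) : Sphere n :=
  if h : x = 0 then ⟨EuclideanSpace.single 0 1, by simp⟩
  else ⟨‖x‖⁻¹ • x, by simp [norm_smul, h]⟩

lemma coe_dir {n : ℕ} [NeZero n] {x : Space n} (h : x ≠ 0) :
    (dir x : Space n) = ‖x‖⁻¹ • x := by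
  simp [dir, h]

lemma norm_smul_dir {n : ℕ} [NeZero n] (x : Space n) :
    ‖x‖ • (dir x : Space n) = x := by
  by_cases h : x = 0
  · simp [h]
  · simp [coe_dir h, smul_smul, h]

@[simp]
lemma dir_coe {n : ℕ} [NeZero n] (θ : Sphere n) : dir (θ : Space n) = θ := by
  have h : (θ : Space n) ≠ 0 := ne_zero_of_mem_unit_sphere θ
  ext1
  simp [coe_dir h]

lemma dir_smul {n : ℕ} [NeZero n] {t : ℝ} (ht : 0 < t) {x : Space n} (hx : x ≠ 0) :
    dir (t • x) = dir x := by
  have h : t • x ≠ 0 := by simp [ht.ne', hx]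
  ext1
  rw [coe_dir h, coe_dir hx, norm_smul, Real.norm_of_nonneg ht.le, smul_smul]
  congr 1
  field_simp

@[fun_prop]
lemma measurable_dir {n : ℕ} [NeZero n] : Measurable (dir : Space n → Sphere n) := by
  have h : Measurable fun x : Space n => (dir x : Space n) := by
    have : (fun x : Space n => (dir x : Space n)) =
        fun x => if x = 0 then EuclideanSpace.single 0 1 else ‖x‖⁻¹ • x := by
      ext1 x
      split_ifs with h
      · simp [dir, h]
      · exact coe_dir h
    rw [this]
    exact Measurable.ite (measurableSet_singleton 0) (by fun_prop) (by fun_prop)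
  exact h.subtype_mk

/-- Off the origin, Lebesgue measure is the product of the surface measure and `r ^ (n - 1) dr`, so
a product of an angular and a radial function integrates to a product. -/
lemma lintegral_volume_polar {n : ℕ} [NeZero n] {a : Sphere n → ℝ≥0∞} {k : ℝ → ℝ≥0∞}
    (ha : Measurable a) (hk : Measurable k) :
    ∫⁻ x : Space n, a (dir x) * k ‖x‖ =
      (∫⁻ θ, a θ ∂(volume : Measure (Space n)).toSphere) *
        ∫⁻ r : Set.Ioi (0 : ℝ), k r ∂(.volumeIoiPow (n - 1)) := by
  have hp := (volume : Measure (Space n)).measurePreserving_homeomorphUnitSphereProd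
  rw [finrank_euclideanSpace_fin] at hp
  calc ∫⁻ x : Space n, a (dir x) * k ‖x‖
      = ∫⁻ x : ({(0)}ᶜ : Set (Space n)), a (dir (x : Space n)) * k ‖(x : Space n)‖
          ∂(volume.comap Subtype.val) := by
        conv_lhs => rw [← restrict_compl_singleton (μ := (volume : Measure (Space n))) 0]
        exact (lintegral_subtype_comap (measurableSet_singleton _).compl
          (fun x : Space n => a (dir x) * k ‖x‖)).symm
    _ = ∫⁻ z, a z.1 * k z.2 ∂(volume : Measure (Space n)).toSphere.prod
          (.volumeIoiPow (n - 1)) := by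
        rw [← hp.lintegral_comp (by fun_prop)]
        refine lintegral_congr fun x => ?_
        have : dir (x : Space n) = ((homeomorphUnitSphereProd (Space n)) x).1 := by
          ext1
          rw [coe_dir x.2, homeomorphUnitSphereProd_apply_fst_coe]
        rw [this, homeomorphUnitSphereProd_apply_snd_coe]
    _ = _ := lintegral_prod_mul (f := a) (g := fun r : Set.Ioi (0 : ℝ) => k r)
          (by fun_prop) (by fun_prop)

instance (n : ℕ) [NeZero n] : IsProbabilityMeasure (sigma n) := by
  constructor
  have h : (volume : Measure (Space n)).toSphere Set.univ ≠ 0 := by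
    simp only [ne_eq, Measure.measure_univ_eq_zero]
    exact Measure.toSphere_ne_zero _
  rw [sigma, Measure.smul_apply, smul_eq_mul, ENNReal.inv_mul_cancel h (measure_ne_top _ _)]

/-- The direction and the norm of a Gaussian vector are independent, the direction being uniform. -/
lemma map_dir_norm_gauss (n : ℕ) [NeZero n] :
    (gauss n).map (fun x => (dir x, ‖x‖)) = (sigma n).prod ((gauss n).map (‖·‖)) := by
  have : IsProbabilityMeasure ((gauss n).map (‖·‖)) :=
    Measure.isProbabilityMeasure_map (by fun_prop)
  refine (Measure.prod_eq fun s t hs ht => ?_).symm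
  set r : ℝ → ℝ≥0∞ := fun u => ENNReal.ofReal
    ((∫ y : Space n, Real.exp (-(1 / 2) * ‖y‖ ^ 2))⁻¹ * Real.exp (-(1 / 2) * u ^ 2)) with hr
  have hrm : Measurable r := by fun_prop
  -- The measure of a rectangle factors. The radial factor is not computed: comparison with the case
  -- where `s` is the whole sphere eliminates it.
  have key : ∀ s : Set (Sphere n), MeasurableSet s →
      (gauss n) {x | dir x ∈ s ∧ ‖x‖ ∈ t} = (volume : Measure (Space n)).toSphere s *
        ∫⁻ u : Set.Ioi (0 : ℝ), t.indicator r u ∂(.volumeIoiPow (n - 1)) := by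
    intro s hs
    have hm : MeasurableSet {x : Space n | dir x ∈ s ∧ ‖x‖ ∈ t} :=
      (measurable_dir hs).inter (measurable_norm ht)
    rw [← lintegral_indicator_one hm, lintegral_gauss, ← lintegral_indicator_one hs,
      ← lintegral_volume_polar (by measurability) (by measurability)]
    refine lintegral_congr fun x => ?_
    by_cases h1 : dir x ∈ s <;> by_cases h2 : ‖x‖ ∈ t <;>
      simp [Set.indicator, h1, h2, hr, gaussDensity]
  have h0 : (volume : Measure (Space n)).toSphere Set.univ ≠ 0 := by
    simp only [ne_eq, Measure.measure_univ_eq_zero]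
    exact Measure.toSphere_ne_zero _
  rw [Measure.map_apply (by fun_prop) (hs.prod ht), Measure.map_apply (by fun_prop) ht]
  have e1 : (fun x : Space n => (dir x, ‖x‖)) ⁻¹' s ×ˢ t = {x | dir x ∈ s ∧ ‖x‖ ∈ t} := rfl
  have e2 : (fun x : Space n => ‖x‖) ⁻¹' t = {x | dir x ∈ Set.univ ∧ ‖x‖ ∈ t} := by
    ext x; simp
  rw [e1, e2, key s hs, key _ .univ, sigma, Measure.smul_apply, smul_eq_mul,
    mul_mul_mul_comm, ENNReal.inv_mul_cancel h0 (measure_ne_top _ _), one_mul]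

lemma lintegral_gauss_polar {n : ℕ} [NeZero n] {a : Sphere n → ℝ≥0∞} {k : ℝ → ℝ≥0∞}
    (ha : Measurable a) (hk : Measurable k) :
    ∫⁻ x, a (dir x) * k ‖x‖ ∂(gauss n) =
      (∫⁻ θ, a θ ∂(sigma n)) * ∫⁻ x, k ‖x‖ ∂(gauss n) := by
  have : IsProbabilityMeasure ((gauss n).map (‖·‖)) :=
    Measure.isProbabilityMeasure_map (by fun_prop)
  rw [← lintegral_map (f := k) (g := fun x : Space n => ‖x‖) hk (by fun_prop),
    ← lintegral_prod_mul (by fun_prop) (by fun_prop), ← map_dir_norm_gauss,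
    lintegral_map (by fun_prop) (by fun_prop)]

lemma integral_gauss_polar {n : ℕ} [NeZero n] {a : Sphere n → ℝ} {k : ℝ → ℝ}
    (ha : Measurable a) (hk : Measurable k) :
    ∫ x, a (dir x) * k ‖x‖ ∂(gauss n) =
      (∫ θ, a θ ∂(sigma n)) * ∫ x, k ‖x‖ ∂(gauss n) := by
  have : IsProbabilityMeasure ((gauss n).map (‖·‖)) :=
    Measure.isProbabilityMeasure_map (by fun_prop)
  rw [← integral_map (f := k) (φ := fun x : Space n => ‖x‖) (by fun_prop)
      hk.aestronglyMeasurable,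
    ← integral_prod_mul, ← map_dir_norm_gauss,
    integral_map (by fun_prop) (by
      exact (show Measurable fun z : Sphere n × ℝ => a z.1 * k z.2 by
        fun_prop).aestronglyMeasurable)]

/-- The inverse fourth moment of the norm of a Gaussian vector. -/
lemma lintegral_norm_inv_pow_four {n : ℕ} (hn : 5 ≤ n) :
    ∫⁻ x, ENNReal.ofReal (‖x‖⁻¹ ^ 4) ∂(gauss n) =
      ENNReal.ofReal (1 / (((n : ℝ) - 2) * ((n : ℝ) - 4))) := by
  have : NeZero n := ⟨by omega⟩
  have hn' : (5 : ℝ) ≤ n := by exact_mod_cast hn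
  set Z := ∫ y : Space n, Real.exp (-(1 / 2) * ‖y‖ ^ 2) with hZ
  have hZ0 : 0 < Z := integral_exp_norm_sq_pos n
  -- The Jacobian `y ^ (n - 1)` absorbs the singularity `y⁻⁴`; what remains is a Gamma integral with
  -- exponent `n - 5 > -1`.
  have e1 : ∀ y ∈ Set.Ioi (0 : ℝ), y ^ (n - 1) • (y⁻¹ ^ 4 * Real.exp (-(1 / 2) * y ^ 2)) =
      y ^ ((n : ℝ) - 5) * Real.exp (-(1 / 2) * y ^ (2 : ℝ)) := by
    intro y hy
    have hy : 0 < y := hy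
    have : (n : ℝ) - 5 = ((n - 5 : ℕ) : ℝ) := by push_cast [Nat.cast_sub hn]; ring
    rw [this, Real.rpow_natCast, Real.rpow_two, show n - 1 = n - 5 + 4 by omega, pow_add,
      smul_eq_mul]
    field_simp
  have e2 : ∀ y ∈ Set.Ioi (0 : ℝ), y ^ (n - 1) • (Real.exp (-(1 / 2) * y ^ 2)) =
      y ^ ((n : ℝ) - 1) * Real.exp (-(1 / 2) * y ^ (2 : ℝ)) := by
    intro y hy
    have : (n : ℝ) - 1 = ((n - 1 : ℕ) : ℝ) := by rw [Nat.cast_sub (by omega)]; simp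
    rw [this, Real.rpow_natCast, Real.rpow_two, smul_eq_mul]
  have hint : Integrable fun x : Space n => ‖x‖⁻¹ ^ 4 * Real.exp (-(1 / 2) * ‖x‖ ^ 2) := by
    rw [integrable_fun_norm_addHaar (volume : Measure (Space n))
      (f := fun y => y⁻¹ ^ 4 * Real.exp (-(1 / 2) * y ^ 2)), finrank_euclideanSpace_fin,
      integrableOn_congr_fun e1 measurableSet_Ioi]
    exact integrableOn_rpow_mul_exp_neg_mul_rpow (by linarith) two_pos (by norm_num)
  have hZ' : Z = n • (volume : Measure (Space n)).real (Metric.ball 0 1) •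
      ((1 / 2 : ℝ) ^ (-((n : ℝ) - 1 + 1) / 2) * (1 / 2) * Real.Gamma (((n : ℝ) - 1 + 1) / 2)) := by
    rw [hZ, integral_fun_norm_addHaar (volume : Measure (Space n))
      (f := fun y => Real.exp (-(1 / 2) * y ^ 2)), finrank_euclideanSpace_fin,
      setIntegral_congr_fun measurableSet_Ioi e2,
      integral_rpow_mul_exp_neg_mul_rpow two_pos (by linarith) (by norm_num)]
  have hI : ∫ x : Space n, ‖x‖⁻¹ ^ 4 * Real.exp (-(1 / 2) * ‖x‖ ^ 2) =
      Z * (1 / (((n : ℝ) - 2) * ((n : ℝ) - 4))) := by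
    rw [hZ', integral_fun_norm_addHaar (volume : Measure (Space n))
      (f := fun y => y⁻¹ ^ 4 * Real.exp (-(1 / 2) * y ^ 2)), finrank_euclideanSpace_fin,
      setIntegral_congr_fun measurableSet_Ioi e1,
      integral_rpow_mul_exp_neg_mul_rpow two_pos (by linarith) (by norm_num)]
    -- The two Gamma integrals differ by a shift of two in the argument, and `4 (n/2 - 1) (n/2 - 2)
    -- = (n - 2) (n - 4)`.
    have g1 : ((n : ℝ) - 1 + 1) / 2 = ((n : ℝ) - 5 + 1) / 2 + 1 + 1 := by ring
    have g2 : -((n : ℝ) - 1 + 1) / 2 = -((n : ℝ) - 5 + 1) / 2 + (-2) := by ring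
    have h3 : ((1 : ℝ) / 2) ^ (-2 : ℝ) = 4 := by
      rw [Real.rpow_neg (by norm_num), Real.rpow_two]; norm_num
    rw [g1, g2, Real.rpow_add (by norm_num), h3, Real.Gamma_add_one (by linarith),
      Real.Gamma_add_one (by linarith)]
    have h4 : (n : ℝ) - 4 ≠ 0 := by linarith
    have h2 : (n : ℝ) - 2 ≠ 0 := by linarith
    simp only [smul_eq_mul, nsmul_eq_mul]
    field_simp
    ring
  rw [lintegral_gauss]
  have : ∀ x : Space n, ENNReal.ofReal (gaussDensity n x) * ENNReal.ofReal (‖x‖⁻¹ ^ 4) =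
      ENNReal.ofReal (Z⁻¹ * (‖x‖⁻¹ ^ 4 * Real.exp (-(1 / 2) * ‖x‖ ^ 2))) := by
    intro x
    rw [← ENNReal.ofReal_mul (gaussDensity_pos n x).le, gaussDensity, ← hZ]
    ring_nf
  simp_rw [this]
  rw [← ofReal_integral_eq_lintegral_ofReal (hint.const_mul _)
    (.of_forall fun x => by positivity), integral_const_mul, hI, ← mul_assoc,
    inv_mul_cancel₀ hZ0.ne', one_mul]

end SphereCov

namespace SphereCov

/-! ### Rotations of pairs of Gaussian vectors -/

/-- The involution `(x, z) ↦ (cos s x + sin s z, sin s x - cos s z)`. -/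
noncomputable def rot (n : ℕ) (s : ℝ) : Space n × Space n →ₗ[ℝ] Space n × Space n :=
  LinearMap.prod (Real.cos s • LinearMap.fst ℝ _ _ + Real.sin s • LinearMap.snd ℝ _ _)
    (Real.sin s • LinearMap.fst ℝ _ _ - Real.cos s • LinearMap.snd ℝ _ _)

@[simp]
lemma rot_apply {n : ℕ} (s : ℝ) (p : Space n × Space n) :
    rot n s p = (Real.cos s • p.1 + Real.sin s • p.2, Real.sin s • p.1 - Real.cos s • p.2) := rfl

lemma cos_smul_add_sin_smul_rot {n : ℕ} (s : ℝ) (p : Space n × Space n) :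
    Real.cos s • (rot n s p).1 + Real.sin s • (rot n s p).2 = p.1 := by
  have h := Real.cos_sq_add_sin_sq s
  calc _ = (Real.cos s ^ 2 + Real.sin s ^ 2) • p.1 := by rw [rot_apply]; module
    _ = p.1 := by rw [h, one_smul]

lemma cos_smul_sub_sin_smul_rot {n : ℕ} (s : ℝ) (p : Space n × Space n) :
    Real.sin s • (rot n s p).1 - Real.cos s • (rot n s p).2 = p.2 := by
  have h := Real.cos_sq_add_sin_sq s
  calc _ = (Real.cos s ^ 2 + Real.sin s ^ 2) • p.2 := by rw [rot_apply]; module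
    _ = p.2 := by rw [h, one_smul]

lemma rot_rot {n : ℕ} (s : ℝ) (p : Space n × Space n) : rot n s (rot n s p) = p :=
  Prod.ext (cos_smul_add_sin_smul_rot s p) (cos_smul_sub_sin_smul_rot s p)

lemma norm_sq_rot {n : ℕ} (s : ℝ) (p : Space n × Space n) :
    ‖(rot n s p).1‖ ^ 2 + ‖(rot n s p).2‖ ^ 2 = ‖p.1‖ ^ 2 + ‖p.2‖ ^ 2 := by
  simp only [rot_apply, norm_add_sq_real, norm_sub_sq_real, norm_smul, mul_pow,
    real_inner_smul_left, real_inner_smul_right, Real.norm_eq_abs, sq_abs]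
  linear_combination (‖p.1‖ ^ 2 + ‖p.2‖ ^ 2) * Real.cos_sq_add_sin_sq s

@[fun_prop]
lemma measurable_rot {n : ℕ} (s : ℝ) : Measurable (rot n s) :=
  (LinearMap.continuous_of_finiteDimensional _).measurable

/-- An involution has determinant `±1`. -/
lemma measurePreserving_rot_volume (n : ℕ) (s : ℝ) :
    MeasurePreserving (rot n s) ((volume : Measure (Space n)).prod volume)
      ((volume : Measure (Space n)).prod volume) := by
  have h2 : LinearMap.det (rot n s) * LinearMap.det (rot n s) = 1 := by
    rw [← LinearMap.det_comp, ← LinearMap.det_id (A := ℝ) (M := Space n × Space n)]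
    congr 1
    exact LinearMap.ext fun p => rot_rot s p
  have h0 : LinearMap.det (rot n s) ≠ 0 := fun h => by simp [h] at h2
  refine ⟨measurable_rot s, ?_⟩
  rw [Measure.map_linearMap_addHaar_eq_smul_addHaar _ h0]
  rcases mul_self_eq_one_iff.1 h2 with h | h <;> simp [h]

/-- The joint law of two independent standard Gaussian vectors. -/
noncomputable abbrev gaussPair (n : ℕ) : Measure (Space n × Space n) := (gauss n).prod (gauss n)

/-- The joint density depends only on `|x|² + |z|²`, which `rot` preserves. -/
lemma measurePreserving_rot (n : ℕ) (s : ℝ) :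
    MeasurePreserving (rot n s) (gaussPair n) (gaussPair n) := by
  refine ⟨measurable_rot s, ?_⟩
  have hd : ∀ p : Space n × Space n, ENNReal.ofReal (gaussDensity n (rot n s p).1) *
      ENNReal.ofReal (gaussDensity n (rot n s p).2) =
      ENNReal.ofReal (gaussDensity n p.1) * ENNReal.ofReal (gaussDensity n p.2) := by
    intro p
    rw [← ENNReal.ofReal_mul (gaussDensity_pos n _).le,
      ← ENNReal.ofReal_mul (gaussDensity_pos n _).le]
    congr 1
    unfold gaussDensity
    rw [mul_mul_mul_comm, ← Real.exp_add, ← mul_add, norm_sq_rot, mul_add, Real.exp_add,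
      mul_mul_mul_comm]
  have hg : gaussPair n = ((volume : Measure (Space n)).prod volume).withDensity
      fun p => ENNReal.ofReal (gaussDensity n p.1) * ENNReal.ofReal (gaussDensity n p.2) := by
    rw [gaussPair, gauss, prod_withDensity (by fun_prop) (by fun_prop)]
  ext A hA
  have hA' : MeasurableSet (rot n s ⁻¹' A) := measurable_rot s hA
  rw [Measure.map_apply (measurable_rot s) hA, hg, withDensity_apply _ hA,
    withDensity_apply _ hA', ← lintegral_indicator hA, ← lintegral_indicator hA',
    ← (measurePreserving_rot_volume n s).lintegral_comp
      (Measurable.indicator (s := A) (by fun_prop) hA)]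
  refine lintegral_congr fun p => ?_
  by_cases hp : rot n s p ∈ A
  · rw [Set.indicator_of_mem (show p ∈ rot n s ⁻¹' A from hp), Set.indicator_of_mem hp, hd]
  · rw [Set.indicator_of_notMem (show p ∉ rot n s ⁻¹' A from hp), Set.indicator_of_notMem hp]

lemma integrable_norm_gauss (n : ℕ) : Integrable (fun x => ‖x‖) (gauss n) := by
  rw [integrable_gauss_iff]
  have h4 : Integrable fun y : Space n => Real.exp (-(1 / 4) * ‖y‖ ^ 2) := by
    by_contra h
    have := integral_undef h
    rw [GaussianFourier.integral_rexp_neg_mul_sq_norm (by norm_num)] at this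
    exact absurd this (by positivity)
  refine (h4.const_mul (∫ y : Space n, Real.exp (-(1 / 2) * ‖y‖ ^ 2))⁻¹).mono'
    (by fun_prop) (.of_forall fun x => ?_)
  have h0 := integral_exp_norm_sq_pos n
  rw [Real.norm_of_nonneg (mul_nonneg (gaussDensity_pos n x).le (norm_nonneg x)), gaussDensity,
    mul_assoc]
  gcongr
  -- `(‖x‖/2 - 1)² ≥ 0` gives `‖x‖ ≤ 1 + ‖x‖²/4`. Half of the Gaussian exponent is spent on the
  -- factor `‖x‖`, half is kept for integrability.
  have h1 : ‖x‖ ≤ Real.exp (1 / 4 * ‖x‖ ^ 2) := by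
    have := Real.add_one_le_exp (1 / 4 * ‖x‖ ^ 2)
    nlinarith [sq_nonneg (‖x‖ / 2 - 1)]
  calc Real.exp (-(1 / 2) * ‖x‖ ^ 2) * ‖x‖
      ≤ Real.exp (-(1 / 2) * ‖x‖ ^ 2) * Real.exp (1 / 4 * ‖x‖ ^ 2) := by gcongr
    _ = _ := by rw [← Real.exp_add]; ring_nf

/-! ### Bounded smooth functions and Gaussian integration by parts. -/

/-- `F` is `C¹`-smooth and bounded together with its derivative. -/
structure BddC1 {n : ℕ} (F : Space n → ℝ) : Prop where
  contDiff : ContDiff ℝ 1 F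
  bdd : ∃ C, ∀ x, |F x| ≤ C
  bdd_fderiv : ∃ C, ∀ x, ‖fderiv ℝ F x‖ ≤ C

/-- The `i`-th partial derivative. -/
noncomputable def pderiv {n : ℕ} (i : Fin n) (F : Space n → ℝ) (x : Space n) : ℝ :=
  fderiv ℝ F x (EuclideanSpace.single i 1)

lemma fderiv_apply_eq_sum {n : ℕ} (F : Space n → ℝ) (x v : Space n) :
    fderiv ℝ F x v = ∑ i, v i * pderiv i F x := by
  conv_lhs => rw [← (EuclideanSpace.basisFun (Fin n) ℝ).sum_repr v]
  simp [pderiv]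

namespace BddC1

variable {n : ℕ} {F G : Space n → ℝ}

lemma differentiable (hF : BddC1 F) : Differentiable ℝ F := hF.contDiff.differentiable one_ne_zero

lemma continuous (hF : BddC1 F) : Continuous F := hF.contDiff.continuous

lemma continuous_pderiv (hF : BddC1 F) (i : Fin n) : Continuous (pderiv i F) :=
  (hF.contDiff.continuous_fderiv one_ne_zero).clm_apply continuous_const

lemma bdd_pderiv (hF : BddC1 F) (i : Fin n) : ∃ C, ∀ x, |pderiv i F x| ≤ C := by
  obtain ⟨C, hC⟩ := hF.bdd_fderiv
  refine ⟨C, fun x => ?_⟩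
  have := (fderiv ℝ F x).le_opNorm (EuclideanSpace.single i 1)
  simp only [PiLp.norm_single, norm_one, mul_one] at this
  exact this.trans (hC x)

end BddC1

variable {n : ℕ} {F G : Space n → ℝ}

lemma integrable_of_continuous_of_bdd {α : Type*} [TopologicalSpace α] [MeasurableSpace α]
    [OpensMeasurableSpace α] {μ : Measure α} [IsFiniteMeasure μ] {h : α → ℝ} (hc : Continuous h)
    (hb : ∃ C, ∀ x, |h x| ≤ C) : Integrable h μ := by
  obtain ⟨C, hC⟩ := hb
  exact (integrable_const C).mono' hc.measurable.aestronglyMeasurable (.of_forall hC)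

lemma fderiv_gaussDensity (i : Fin n) (x : Space n) :
    fderiv ℝ (gaussDensity n) x (EuclideanSpace.single i 1) = - (x i * gaussDensity n x) := by
  have h : HasFDerivAt (gaussDensity n) ((∫ y : Space n, Real.exp (-(1 / 2) * ‖y‖ ^ 2))⁻¹ •
      (Real.exp (-(1 / 2) * ‖x‖ ^ 2) • ((-(1 / 2) : ℝ) • (2 • innerSL ℝ x)))) x :=
    (((hasStrictFDerivAt_norm_sq x).hasFDerivAt.const_mul _).exp).const_mul _
  rw [h.fderiv]
  simp [gaussDensity, EuclideanSpace.inner_single_right]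
  ring

/-- Integration by parts for the Gaussian measure. -/
lemma integral_mul_coord_gauss (hF : BddC1 F) (i : Fin n) :
    ∫ z, F z * z i ∂(gauss n) = ∫ z, pderiv i F z ∂(gauss n) := by
  have hi : Integrable (fun z : Space n => F z * z i) (gauss n) := by
    obtain ⟨C, hC⟩ := hF.bdd
    refine ((integrable_norm_gauss n).const_mul C).mono' ?_ (.of_forall fun z => ?_)
    · have := hF.continuous
      exact (by fun_prop : Continuous fun z : Space n => F z * z i).aestronglyMeasurable
    · rw [norm_mul]
      exact mul_le_mul (hC z) (PiLp.norm_apply_le z i) (norm_nonneg _)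
        ((abs_nonneg _).trans (hC z))
  have hd : Integrable (pderiv i F) (gauss n) :=
    integrable_of_continuous_of_bdd (hF.continuous_pderiv i) (hF.bdd_pderiv i)
  have hF0 : Integrable F (gauss n) := integrable_of_continuous_of_bdd hF.continuous hF.bdd
  rw [integrable_gauss_iff] at hi hd hF0
  rw [integral_gauss, integral_gauss]
  have key := integral_mul_fderiv_eq_neg_fderiv_mul_of_integrable (μ := volume)
    (f := F) (g := gaussDensity n) (v := EuclideanSpace.single i 1)
    (hd.congr (.of_forall fun x => by simp only [pderiv]; ring))
    (hi.neg.congr (.of_forall fun x => by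
      simp only [fderiv_gaussDensity, Pi.neg_apply]; ring))
    (hF0.congr (.of_forall fun x => by simp only []; ring))
    (fun x _ => hF.differentiable x)
    (fun x _ => (contDiff_gaussDensity n).differentiable (by simp) x)
  simp only [fderiv_gaussDensity] at key
  rw [← neg_eq_iff_eq_neg, ← integral_neg] at key
  calc _ = ∫ x, -(F x * -(x i * gaussDensity n x)) := by congr 1; ext x; ring
    _ = ∫ x, fderiv ℝ F x (EuclideanSpace.single i 1) * gaussDensity n x := key
    _ = _ := by congr 1; ext x; simp only [pderiv]; ring

/-! ### Gaussian interpolation -/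

/-- The correlation `𝔼 F(X) G(cos s X + sin s Z)` for independent Gaussian `X`, `Z`. -/
noncomputable def cor (F G : Space n → ℝ) (s : ℝ) : ℝ :=
  ∫ p, F p.1 * G (Real.cos s • p.1 + Real.sin s • p.2) ∂(gaussPair n)

lemma integral_rot (s : ℝ) {h : Space n × Space n → ℝ} (hh : AEStronglyMeasurable h (gaussPair n)) :
    ∫ p, h (rot n s p) ∂(gaussPair n) = ∫ p, h p ∂(gaussPair n) := by
  conv_rhs => rw [← (measurePreserving_rot n s).map_eq]
  rw [integral_map (by fun_prop) (by rwa [(measurePreserving_rot n s).map_eq])]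

/-- `rot` exchanges `X` and `Y = cos s X + sin s Z` and preserves the joint law. -/
lemma cor_comm (hF : Continuous F) (hG : Continuous G) (s : ℝ) : cor F G s = cor G F s := by
  unfold cor
  rw [← integral_rot s (by
    exact Continuous.aestronglyMeasurable (by fun_prop))]
  simp_rw [cos_smul_add_sin_smul_rot, rot_apply, mul_comm]

lemma cor_zero (F G : Space n → ℝ) (h : Measurable fun x => F x * G x) :
    cor F G 0 = ∫ x, F x * G x ∂(gauss n) := by
  simp only [cor, Real.cos_zero, one_smul, Real.sin_zero, zero_smul, add_zero]
  exact (measurePreserving_fst (μ := gauss n) (ν := gauss n)).map_eq ▸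
    (integral_map (φ := Prod.fst) (μ := gaussPair n) (f := fun x => F x * G x)
      measurable_fst.aemeasurable h.aestronglyMeasurable).symm

lemma cor_pi_div_two (F G : Space n → ℝ) :
    cor F G (Real.pi / 2) = (∫ x, F x ∂(gauss n)) * ∫ x, G x ∂(gauss n) := by
  simp only [cor, Real.cos_pi_div_two, Real.sin_pi_div_two, one_smul, zero_smul, zero_add]
  exact integral_prod_mul F G

lemma integrable_norm_fst_add_norm_snd (n : ℕ) :
    Integrable (fun p : Space n × Space n => ‖p.1‖ + ‖p.2‖) (gaussPair n) :=
  ((integrable_norm_gauss n).comp_fst _).add ((integrable_norm_gauss n).comp_snd _)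

lemma BddC1.comp_affine (hF : BddC1 F) (a : Space n) (t : ℝ) :
    BddC1 (fun z => F (a + t • z)) ∧ ∀ i z, pderiv i (fun z => F (a + t • z)) z =
      t * pderiv i F (a + t • z) := by
  have hd : ∀ z, HasFDerivAt (fun z => F (a + t • z)) (t • fderiv ℝ F (a + t • z)) z := by
    intro z
    have h1 : HasFDerivAt (fun z : Space n => a + t • z) (t • ContinuousLinearMap.id ℝ _) z :=
      ((hasFDerivAt_id z).const_smul t).const_add a
    refine ((hF.differentiable (a + t • z)).hasFDerivAt.comp z h1).congr_fderiv ?_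
    ext v
    simp
  refine ⟨⟨?_, ?_, ?_⟩, ?_⟩
  · have := hF.contDiff
    fun_prop
  · obtain ⟨C, hC⟩ := hF.bdd
    exact ⟨C, fun z => hC _⟩
  · obtain ⟨C, hC⟩ := hF.bdd_fderiv
    refine ⟨|t| * C, fun z => ?_⟩
    rw [(hd z).fderiv, norm_smul]
    exact mul_le_mul_of_nonneg_left (hC _) (abs_nonneg t)
  · intro i z
    simp [pderiv, (hd z).fderiv]

/-- Differentiation under the integral produces `F(X) G'(Y)(-sin s X + cos s Z)`. The rotation turns
it into `-F(Y) G'(X)(Z)`, where `Z` is independent of `X`, and integration by parts in `Z` moves the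
derivative to `F` with a factor `sin s`. -/
lemma hasDerivAt_cor (hF : BddC1 F) (hG : BddC1 G) (s : ℝ) :
    HasDerivAt (cor F G) (-Real.sin s * ∑ i, cor (pderiv i F) (pderiv i G) s) s := by
  obtain ⟨CF, hCF⟩ := hF.bdd
  obtain ⟨CG, hCG⟩ := hG.bdd_fderiv
  have hFc := hF.continuous
  have hGc := hG.continuous
  have hG'c : Continuous (fderiv ℝ G) := hG.contDiff.continuous_fderiv one_ne_zero
  have hCF0 : 0 ≤ CF := (abs_nonneg _).trans (hCF 0)
  have hCG0 : 0 ≤ CG := (norm_nonneg _).trans (hCG 0)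
  have h1 : HasDerivAt (cor F G) (∫ p, F p.1 * fderiv ℝ G (Real.cos s • p.1 + Real.sin s • p.2)
      (-Real.sin s • p.1 + Real.cos s • p.2) ∂(gaussPair n)) s := by
    refine (hasDerivAt_integral_of_dominated_loc_of_deriv_le (μ := gaussPair n)
      (F := fun s p => F p.1 * G (Real.cos s • p.1 + Real.sin s • p.2))
      (F' := fun s p => F p.1 * fderiv ℝ G (Real.cos s • p.1 + Real.sin s • p.2)
        (-Real.sin s • p.1 + Real.cos s • p.2)) (s := Set.univ)
      (bound := fun p => CF * (CG * (‖p.1‖ + ‖p.2‖))) Filter.univ_mem ?_ ?_ ?_ ?_ ?_ ?_).2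
    · exact .of_forall fun u => Continuous.aestronglyMeasurable (by fun_prop)
    · refine integrable_of_continuous_of_bdd (by fun_prop) ?_
      obtain ⟨C, hC⟩ := hG.bdd
      exact ⟨CF * C, fun p => by
        rw [abs_mul]; exact mul_le_mul (hCF _) (hC _) (abs_nonneg _) hCF0⟩
    · exact Continuous.aestronglyMeasurable (by fun_prop)
    · refine .of_forall fun p u _ => ?_
      rw [norm_mul]
      refine mul_le_mul (hCF _) ?_ (norm_nonneg _) hCF0
      refine ((fderiv ℝ G _).le_opNorm _).trans (mul_le_mul (hCG _) ?_ (norm_nonneg _) hCG0)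
      refine (norm_add_le _ _).trans (add_le_add ?_ ?_)
      · rw [norm_smul, norm_neg]
        exact mul_le_of_le_one_left (norm_nonneg _) (Real.abs_sin_le_one u)
      · rw [norm_smul]
        exact mul_le_of_le_one_left (norm_nonneg _) (Real.abs_cos_le_one u)
    · exact ((integrable_norm_fst_add_norm_snd n).const_mul CG).const_mul CF
    · refine .of_forall fun p u _ => HasDerivAt.const_mul _ ?_
      refine (hG.differentiable _).hasFDerivAt.comp_hasDerivAt u ?_
      exact ((Real.hasDerivAt_cos u).smul_const p.1).add ((Real.hasDerivAt_sin u).smul_const p.2)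
  convert h1 using 1
  -- The velocity `-sin s X + cos s Z` is minus the second component of `rot`, so after the rotation
  -- it is simply `-Z`.
  rw [← integral_rot s (Continuous.aestronglyMeasurable (by fun_prop))]
  have h2 : ∀ p : Space n × Space n, F (rot n s p).1 *
      fderiv ℝ G (Real.cos s • (rot n s p).1 + Real.sin s • (rot n s p).2)
        (-Real.sin s • (rot n s p).1 + Real.cos s • (rot n s p).2) =
      ∑ i, -(pderiv i G p.1 * (F (Real.cos s • p.1 + Real.sin s • p.2) * p.2 i)) := by
    intro p
    have : -Real.sin s • (rot n s p).1 + Real.cos s • (rot n s p).2 = -p.2 := by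
      rw [← cos_smul_sub_sin_smul_rot s p]; module
    rw [cos_smul_add_sin_smul_rot, this, fderiv_apply_eq_sum, Finset.mul_sum]
    refine Finset.sum_congr rfl fun i _ => ?_
    simp only [rot_apply, PiLp.neg_apply]
    ring
  have h3 : ∀ i, Integrable (fun p : Space n × Space n =>
      pderiv i G p.1 * (F (Real.cos s • p.1 + Real.sin s • p.2) * p.2 i)) (gaussPair n) := by
    intro i
    have hGi := hG.continuous_pderiv i
    obtain ⟨C, hC⟩ := hG.bdd_pderiv i
    have hC0 : 0 ≤ C := (abs_nonneg _).trans (hC 0)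
    refine ((integrable_norm_fst_add_norm_snd n).const_mul (C * CF)).mono'
      (Continuous.aestronglyMeasurable (by fun_prop)) (.of_forall fun p => ?_)
    rw [norm_mul, norm_mul, mul_assoc]
    refine mul_le_mul (hC _) (mul_le_mul (hCF _) ?_ (norm_nonneg _) hCF0) (by positivity) hC0
    exact (PiLp.norm_apply_le p.2 i).trans (le_add_of_nonneg_left (norm_nonneg _))
  simp_rw [h2]
  rw [integral_finsetSum _ fun i _ => (h3 i).fun_neg, Finset.mul_sum]
  refine Finset.sum_congr rfl fun i _ => ?_
  rw [integral_neg, integral_prod _ (h3 i), neg_mul, neg_inj,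
    cor_comm (hF.continuous_pderiv i) (hG.continuous_pderiv i), cor]
  have h4 : Integrable (fun p : Space n × Space n => pderiv i G p.1 *
      pderiv i F (Real.cos s • p.1 + Real.sin s • p.2)) (gaussPair n) := by
    have hFi := hF.continuous_pderiv i
    have hGi := hG.continuous_pderiv i
    refine integrable_of_continuous_of_bdd (by fun_prop) ?_
    obtain ⟨C, hC⟩ := hG.bdd_pderiv i
    obtain ⟨D, hD⟩ := hF.bdd_pderiv i
    exact ⟨C * D, fun p => by
      rw [abs_mul]; exact mul_le_mul (hC _) (hD _) (abs_nonneg _) ((abs_nonneg _).trans (hC 0))⟩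
  rw [integral_prod _ h4, ← integral_const_mul]
  refine integral_congr_ae (.of_forall fun x => ?_)
  -- With `X = x` frozen, `z ↦ F(cos s x + sin s z)` is again an admissible function of `z`, and the
  -- chain rule supplies `sin s`.
  obtain ⟨hb, hp⟩ := hF.comp_affine (Real.cos s • x) (Real.sin s)
  simp only [integral_const_mul]
  rw [integral_mul_coord_gauss hb i]
  simp_rw [hp, integral_const_mul]
  ring

/-- Gaussian interpolation: a bound on the correlations of the gradients controls the difference
between the correlations and the products of the means. -/
lemma abs_sum_cor_sub_le {ι : Type*} [Fintype ι] {F G : ι → Space n → ℝ}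
    (hF : ∀ k, BddC1 (F k)) (hG : ∀ k, BddC1 (G k)) {M : ℝ}
    (hM : ∀ u ∈ Set.Icc 0 (Real.pi / 2),
      |∑ k, ∑ i, cor (pderiv i (F k)) (pderiv i (G k)) u| ≤ M)
    {s : ℝ} (hs : s ∈ Set.Icc 0 (Real.pi / 2)) :
    |∑ k, cor (F k) (G k) s - ∑ k, (∫ x, F k x ∂(gauss n)) * ∫ x, G k x ∂(gauss n)| ≤ M := by
  set h : ℝ → ℝ := fun s => ∑ k, cor (F k) (G k) s with hh
  set D : ℝ → ℝ := fun s => ∑ k, ∑ i, cor (pderiv i (F k)) (pderiv i (G k)) s with hD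
  have hd : ∀ u, HasDerivAt h (-Real.sin u * D u) u := by
    intro u
    rw [hD]
    simp only [Finset.mul_sum (s := (Finset.univ : Finset ι))]
    exact HasDerivAt.fun_sum fun k _ => hasDerivAt_cor (hF k) (hG k) u
  have hsin : ∀ u ∈ interior (Set.Icc 0 (Real.pi / 2)), 0 ≤ Real.sin u ∧ |D u| ≤ M := by
    intro u hu
    have hu := interior_subset hu
    exact ⟨Real.sin_nonneg_of_nonneg_of_le_pi hu.1 (by linarith [hu.2, Real.pi_pos]), hM u hu⟩
  -- The derivative `-sin u * D u` lies between `± M sin u`, so adding or subtracting `M cos u`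
  -- makes `h` monotone. Comparison with `π/2`, where the cosine vanishes, bounds the difference by
  -- `M cos s ≤ M`.
  have hdc : ∀ u, HasDerivAt (fun u => h u + M * Real.cos u)
      (-Real.sin u * D u + M * (-Real.sin u)) u :=
    fun u => (hd u).add ((Real.hasDerivAt_cos u).const_mul M)
  have hdc' : ∀ u, HasDerivAt (fun u => h u - M * Real.cos u)
      (-Real.sin u * D u - M * (-Real.sin u)) u :=
    fun u => (hd u).sub ((Real.hasDerivAt_cos u).const_mul M)
  have hend : Real.pi / 2 ∈ Set.Icc 0 (Real.pi / 2) := ⟨by positivity, le_rfl⟩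
  have hanti : AntitoneOn (fun u => h u + M * Real.cos u) (Set.Icc 0 (Real.pi / 2)) := by
    refine antitoneOn_of_deriv_nonpos (convex_Icc _ _)
      (fun u _ => (hdc u).continuousAt.continuousWithinAt)
      (fun u _ => (hdc u).differentiableAt.differentiableWithinAt) fun u hu => ?_
    rw [(hdc u).deriv]
    obtain ⟨h1, h2⟩ := hsin u hu
    nlinarith [(abs_le.1 h2).1]
  have hmono : MonotoneOn (fun u => h u - M * Real.cos u) (Set.Icc 0 (Real.pi / 2)) := by
    refine monotoneOn_of_deriv_nonneg (convex_Icc _ _)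
      (fun u _ => (hdc' u).continuousAt.continuousWithinAt)
      (fun u _ => (hdc' u).differentiableAt.differentiableWithinAt) fun u hu => ?_
    rw [(hdc' u).deriv]
    obtain ⟨h1, h2⟩ := hsin u hu
    nlinarith [(abs_le.1 h2).2]
  have e1 := hanti hs hend hs.2
  have e2 := hmono hs hend hs.2
  have hpi : h (Real.pi / 2) = ∑ k, (∫ x, F k x ∂(gauss n)) * ∫ x, G k x ∂(gauss n) := by
    simp only [hh, cor_pi_div_two]
  have hM0 : 0 ≤ M := (abs_nonneg _).trans (hM s hs)
  simp only [hpi, Real.cos_pi_div_two, mul_zero, add_zero, sub_zero] at e1 e2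
  have hc : M * Real.cos s ≤ M := mul_le_of_le_one_right hM0 (Real.cos_le_one s)
  exact abs_le.2 ⟨by linarith, by linarith⟩

end SphereCov

namespace SphereCov

/-! ### Hölder's inequality for the directions of correlated Gaussian vectors -/

/-- The weight `|x|⁻²`. -/
noncomputable def invSq {n : ℕ} (x : Space n) : ℝ≥0∞ := ENNReal.ofReal (‖x‖⁻¹ ^ 2)

@[fun_prop]
lemma measurable_invSq {n : ℕ} : Measurable (invSq : Space n → ℝ≥0∞) := by
  unfold invSq; fun_prop

lemma invSq_sq {n : ℕ} (x : Space n) : invSq x ^ 2 = ENNReal.ofReal (‖x‖⁻¹ ^ 4) := by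
  rw [invSq, ← ENNReal.ofReal_pow (by positivity)]
  ring_nf

lemma invSq_congr {n : ℕ} {x y : Space n} (h : ‖x‖ = ‖y‖) : invSq x = invSq y := by
  simp [invSq, h]

/-- The inverse fourth moment of the norm of a Gaussian vector. -/
noncomputable def invFourth (n : ℕ) : ℝ≥0∞ :=
  ENNReal.ofReal (1 / (((n : ℝ) - 2) * ((n : ℝ) - 4)))

/-- The law of a pair of Gaussian vectors `X`, `Y = cos s X + sin s Z`, weighted by
`|X|⁻² |Y|⁻²`. -/
noncomputable def weightedPair (n : ℕ) (s : ℝ) : Measure (Space n × Space n) :=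
  (gaussPair n).withDensity fun p => invSq p.1 * invSq (rot n s p).1

lemma lintegral_weightedPair {n : ℕ} (s : ℝ) {h : Space n × Space n → ℝ≥0∞} (hh : Measurable h) :
    ∫⁻ p, h p ∂(weightedPair n s) = ∫⁻ p, invSq p.1 * invSq (rot n s p).1 * h p ∂(gaussPair n) := by
  rw [weightedPair, lintegral_withDensity_eq_lintegral_mul _ (by fun_prop) hh]
  rfl

lemma lintegral_rot {n : ℕ} (s : ℝ) {h : Space n × Space n → ℝ≥0∞} (hh : Measurable h) :
    ∫⁻ p, h (rot n s p) ∂(gaussPair n) = ∫⁻ p, h p ∂(gaussPair n) :=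
  (measurePreserving_rot n s).lintegral_comp hh

lemma lintegral_fst_gaussPair {n : ℕ} {h : Space n → ℝ≥0∞} (hh : Measurable h) :
    ∫⁻ p, h p.1 ∂(gaussPair n) = ∫⁻ x, h x ∂(gauss n) :=
  (measurePreserving_fst (μ := gauss n) (ν := gauss n)).lintegral_comp hh

/-- The weight is symmetric under the exchange of `X` and `Y` by `rot`, so both marginals of the
weighted law agree. -/
lemma lintegral_snd_weightedPair {n : ℕ} (s : ℝ) {h : Space n → ℝ≥0∞} (hh : Measurable h) :
    ∫⁻ p, h (rot n s p).1 ∂(weightedPair n s) = ∫⁻ p, h p.1 ∂(weightedPair n s) := by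
  rw [lintegral_weightedPair s (by fun_prop), lintegral_weightedPair s (by fun_prop),
    ← lintegral_rot s (by fun_prop)]
  refine lintegral_congr fun p => ?_
  rw [rot_rot, mul_comm (invSq _)]

lemma lintegral_gauss_isometry {n : ℕ} (e : Space n ≃ₗᵢ[ℝ] Space n) (h : Space n → ℝ≥0∞) :
    ∫⁻ z, h (e z) ∂(gauss n) = ∫⁻ z, h z ∂(gauss n) := by
  rw [lintegral_gauss, lintegral_gauss, ← e.measurePreserving.lintegral_comp_emb
    e.toHomeomorph.measurableEmbedding fun z => ENNReal.ofReal (gaussDensity n z) * h z]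
  refine lintegral_congr fun z => ?_
  rw [gaussDensity_eq_of_norm_eq (e.norm_map z)]

/-- The conditional weight depends on the norm only. -/
lemma lintegral_invSq_congr {n : ℕ} (s : ℝ) {x y : Space n} (h : ‖x‖ = ‖y‖) :
    ∫⁻ z, invSq (rot n s (x, z)).1 ∂(gauss n) = ∫⁻ z, invSq (rot n s (y, z)).1 ∂(gauss n) := by
  -- The reflection in the hyperplane orthogonal to `x - y` maps `x` to `y`, the two having equal
  -- norms.
  set e : Space n ≃ₗᵢ[ℝ] Space n := (ℝ ∙ (x - y))ᗮ.reflection with he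
  have hxy : e x = y := Submodule.reflection_sub h
  rw [← lintegral_gauss_isometry e fun z => invSq (rot n s (y, z)).1]
  refine lintegral_congr fun z => invSq_congr ?_
  rw [rot_apply, rot_apply, ← e.norm_map, ← hxy]
  simp

/-- Once `Z` is integrated out, the weight is a radial function of `X`. It therefore leaves the
direction uniform and changes only the total mass. -/
lemma lintegral_dir_weightedPair {n : ℕ} [NeZero n] (s : ℝ) {a : Sphere n → ℝ≥0∞}
    (ha : Measurable a) :
    ∫⁻ p, a (dir p.1) ∂(weightedPair n s) =
      weightedPair n s Set.univ * ∫⁻ θ, a θ ∂(sigma n) := by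
  set K : Space n → ℝ≥0∞ := fun x => ∫⁻ z, invSq (rot n s (x, z)).1 ∂(gauss n) with hK
  have hKm : Measurable K := by
    refine Measurable.lintegral_prod_right' (f := fun p => invSq (rot n s p).1) ?_
    fun_prop
  set k : ℝ → ℝ≥0∞ := fun r =>
    ENNReal.ofReal (r⁻¹ ^ 2) * K (r • EuclideanSpace.single 0 1) with hk
  have hkm : Measurable k := by
    refine Measurable.mul (by fun_prop) (hKm.comp (by fun_prop))
  have key : ∀ a : Sphere n → ℝ≥0∞, Measurable a → ∫⁻ p, a (dir p.1) ∂(weightedPair n s) =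
      (∫⁻ θ, a θ ∂(sigma n)) * ∫⁻ x, k ‖x‖ ∂(gauss n) := by
    intro a ha
    rw [lintegral_weightedPair s (by fun_prop), ← lintegral_gauss_polar ha hkm,
      gaussPair, lintegral_prod _ (by fun_prop)]
    refine lintegral_congr fun x => ?_
    have hx : K (‖x‖ • EuclideanSpace.single 0 1) = K x :=
      lintegral_invSq_congr s (by simp [norm_smul])
    rw [hk]
    simp only [hx]
    rw [lintegral_mul_const _ (by fun_prop), lintegral_const_mul _ (by fun_prop)]
    simp only [hK, invSq]
    ring
  have h1 := key 1 measurable_one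
  simp only [Pi.one_apply, lintegral_one, measure_univ, one_mul] at h1
  rw [key a ha, h1, mul_comm]

lemma map_dir_fst_weightedPair {n : ℕ} [NeZero n] (s : ℝ) :
    (weightedPair n s).map (fun p => dir p.1) = weightedPair n s Set.univ • sigma n := by
  ext A hA
  rw [Measure.smul_apply, smul_eq_mul, ← lintegral_indicator_one hA, ← lintegral_indicator_one hA,
    lintegral_map (measurable_one.indicator hA) (by fun_prop),
    lintegral_dir_weightedPair s (measurable_one.indicator hA)]

lemma map_dir_snd_weightedPair {n : ℕ} [NeZero n] (s : ℝ) :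
    (weightedPair n s).map (fun p => dir (rot n s p).1) =
      weightedPair n s Set.univ • sigma n := by
  ext A hA
  have hm : Measurable (A.indicator (1 : Sphere n → ℝ≥0∞)) := measurable_one.indicator hA
  rw [Measure.smul_apply, smul_eq_mul, ← lintegral_indicator_one hA, ← lintegral_indicator_one hA,
    lintegral_map hm (by fun_prop),
    lintegral_snd_weightedPair s (h := fun x => A.indicator 1 (dir x)) (by fun_prop),
    lintegral_dir_weightedPair s hm]

lemma lintegral_invSq_sq {n : ℕ} (hn : 5 ≤ n) (s : ℝ) :
    ∫⁻ p, invSq p.1 ^ 2 ∂(gaussPair n) = invFourth n ∧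
      ∫⁻ p, invSq (rot n s p).1 ^ 2 ∂(gaussPair n) = invFourth n := by
  have h : ∫⁻ p, invSq p.1 ^ 2 ∂(gaussPair n) = invFourth n := by
    rw [lintegral_fst_gaussPair (h := fun x => invSq x ^ 2) (by fun_prop)]
    simp_rw [invSq_sq]
    exact lintegral_norm_inv_pow_four hn
  exact ⟨h, by rw [lintegral_rot s (h := fun p => invSq p.1 ^ 2) (by fun_prop), h]⟩

/-- Cauchy-Schwarz inequality for the weights, with a cut-off. -/
lemma lintegral_invSq_mul_le {n : ℕ} (hn : 5 ≤ n) (s : ℝ) {a : Space n → ℝ≥0∞}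
    (ha : Measurable a) :
    ∫⁻ p, a p.1 * invSq p.1 * invSq (rot n s p).1 ∂(gaussPair n) ≤
      (∫⁻ x, (a x * invSq x) ^ 2 ∂(gauss n)) ^ (1 / 2 : ℝ) * invFourth n ^ (1 / 2 : ℝ) := by
  have := ENNReal.lintegral_mul_le_Lp_mul_Lq (gaussPair n) Real.HolderConjugate.two_two
    (f := fun p => a p.1 * invSq p.1) (g := fun p => invSq (rot n s p).1)
    (by fun_prop) (by fun_prop)
  simp only [Pi.mul_apply, ENNReal.rpow_two, (lintegral_invSq_sq hn s).2] at this
  rwa [lintegral_fst_gaussPair (h := fun x => (a x * invSq x) ^ 2) (by fun_prop)] at this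

lemma weightedPair_univ_le {n : ℕ} (hn : 5 ≤ n) (s : ℝ) :
    weightedPair n s Set.univ ≤ invFourth n := by
  have h := lintegral_invSq_mul_le hn s (a := 1) measurable_one
  have h1 := (lintegral_invSq_sq hn s).1
  rw [lintegral_fst_gaussPair (h := fun x => invSq x ^ 2) (by fun_prop)] at h1
  simp only [Pi.one_apply, one_mul, h1] at h
  rw [weightedPair, withDensity_apply _ .univ, Measure.restrict_univ]
  refine h.trans_eq ?_
  rw [← ENNReal.rpow_add_of_nonneg _ _ (by norm_num) (by norm_num)]
  norm_num

/-- Hölder's inequality for the directions of a weighted Gaussian pair. -/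
lemma lintegral_dir_mul_dir_le {n : ℕ} (hn : 5 ≤ n) [NeZero n] (s : ℝ) {p q : ℝ≥0∞}
    [hpq : p.HolderConjugate q] {a b : Sphere n → ℝ} (ha : Measurable a) (hb : Measurable b) :
    ∫⁻ z, invSq z.1 * invSq (rot n s z).1 * (‖a (dir z.1)‖ₑ * ‖b (dir (rot n s z).1)‖ₑ)
        ∂(gaussPair n) ≤
      invFourth n * (eLpNorm a p (sigma n) * eLpNorm b q (sigma n)) := by
  set c := weightedPair n s Set.univ with hc
  have h1 : eLpNorm (fun z : Space n × Space n => a (dir z.1)) p (weightedPair n s) ≤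
      c ^ (1 / p).toReal * eLpNorm a p (sigma n) := by
    have := eLpNorm_smul_measure_le c a p (sigma n)
    rwa [hc, ← map_dir_fst_weightedPair,
      eLpNorm_map_measure ha.aestronglyMeasurable (by fun_prop)] at this
  have h2 : eLpNorm (fun z => b (dir (rot n s z).1)) q (weightedPair n s) ≤
      c ^ (1 / q).toReal * eLpNorm b q (sigma n) := by
    have := eLpNorm_smul_measure_le c b q (sigma n)
    rwa [hc, ← map_dir_snd_weightedPair,
      eLpNorm_map_measure hb.aestronglyMeasurable (by fun_prop)] at this
  have h3 := eLpNorm_smul_le_mul_eLpNorm (p := p) (q := q) (r := 1) (μ := weightedPair n s)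
    (f := fun z => b (dir (rot n s z).1)) (φ := fun z => a (dir z.1))
    (Measurable.aestronglyMeasurable (by fun_prop)) (Measurable.aestronglyMeasurable (by fun_prop))
  rw [eLpNorm_one_eq_lintegral_enorm] at h3
  simp only [Pi.smul_apply', smul_eq_mul, enorm_mul] at h3
  rw [lintegral_weightedPair s (by fun_prop)] at h3
  refine h3.trans ((mul_le_mul' h1 h2).trans ?_)
  -- The mass `c` enters with exponents `1/p` and `1/q`, hence with total exponent one, whatever `p`
  -- is.
  have hpq' : (1 / p).toReal + (1 / q).toReal = 1 := by
    have h := ENNReal.HolderConjugate.inv_add_inv_eq_one p q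
    rw [← ENNReal.toReal_add, one_div, one_div, h, ENNReal.toReal_one]
    · exact fun h' => by simp [one_div] at h'; simp [h'] at h
    · exact fun h' => by simp [one_div] at h'; simp [h'] at h
  rw [mul_mul_mul_comm, ← ENNReal.rpow_add_of_nonneg _ _ ENNReal.toReal_nonneg
    ENNReal.toReal_nonneg, hpq', ENNReal.rpow_one]
  gcongr
  exact weightedPair_univ_le hn s

/-- The contribution of a ball to the inverse fourth moment. -/
noncomputable def smallBall (n : ℕ) (ε : ℝ) : ℝ≥0∞ :=
  (∫⁻ x, ({x : Space n | ‖x‖ ≤ ε}.indicator 1 x * invSq x) ^ 2 ∂(gauss n)) ^ (1 / 2 : ℝ) *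
    invFourth n ^ (1 / 2 : ℝ)

/-- Dominated convergence: `|x|⁻⁴` is integrable and the balls shrink to the origin, a null set. -/
lemma tendsto_smallBall {n : ℕ} (hn : 5 ≤ n) :
    Filter.Tendsto (fun N : ℕ => smallBall n (1 / ((N : ℝ) + 1))) Filter.atTop (𝓝 0) := by
  have : NeZero n := ⟨by omega⟩
  have h : Filter.Tendsto (fun N : ℕ => ∫⁻ x,
      ({x : Space n | ‖x‖ ≤ 1 / ((N : ℝ) + 1)}.indicator 1 x * invSq x) ^ 2 ∂(gauss n))
      Filter.atTop (𝓝 (∫⁻ _, 0 ∂(gauss n))) := by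
    refine tendsto_lintegral_of_dominated_convergence (fun x => invSq x ^ 2) ?_ ?_ ?_ ?_
    · intro N
      have : MeasurableSet {x : Space n | ‖x‖ ≤ 1 / ((N : ℝ) + 1)} :=
        measurableSet_le (by fun_prop) (by fun_prop)
      have := (measurable_one (α := ℝ≥0∞)).indicator this
      fun_prop
    · refine fun N => .of_forall fun x => ?_
      refine pow_le_pow_left' (mul_le_of_le_one_left' ?_) 2
      exact Set.indicator_le_self' (by simp) _
    · simp_rw [invSq_sq, lintegral_norm_inv_pow_four hn]
      exact ENNReal.ofReal_ne_top
    · filter_upwards [ae_ne_zero_gauss n] with x hx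
      refine tendsto_const_nhds.congr' ?_
      filter_upwards [tendsto_one_div_add_atTop_nhds_zero_nat.eventually_lt_const
        (norm_pos_iff.2 hx)] with N hN
      rw [Set.indicator_of_notMem (by simpa using hN)]
      simp
  rw [lintegral_zero] at h
  have h2 := ENNReal.Tendsto.mul_const (b := invFourth n ^ (1 / 2 : ℝ))
    (((ENNReal.continuous_rpow_const (y := 1 / 2)).tendsto 0).comp h) (Or.inr (by simp [invFourth]))
  simpa [smallBall] using h2

/-- Functions of homogeneity `-2` up to an error in a ball satisfy a Hölder inequality. -/
lemma lintegral_mul_rot_le {n : ℕ} (hn : 5 ≤ n) [NeZero n] (s : ℝ) {p q : ℝ≥0∞}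
    [hpq : p.HolderConjugate q] {a b : Sphere n → ℝ} (ha : Measurable a) (hb : Measurable b)
    {C : ℝ≥0∞} (haC : ∀ θ, ‖a θ‖ₑ ≤ C) (hbC : ∀ θ, ‖b θ‖ₑ ≤ C) {ε : ℝ} {A B : Space n → ℝ≥0∞}
    (hA : ∀ x, A x ≤ invSq x * (‖a (dir x)‖ₑ + C * {x : Space n | ‖x‖ ≤ ε}.indicator 1 x))
    (hB : ∀ x, B x ≤ invSq x * (‖b (dir x)‖ₑ + C * {x : Space n | ‖x‖ ≤ ε}.indicator 1 x)) :
    ∫⁻ z, A z.1 * B (rot n s z).1 ∂(gaussPair n) ≤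
      invFourth n * (eLpNorm a p (sigma n) * eLpNorm b q (sigma n)) +
        4 * C ^ 2 * smallBall n ε := by
  set I : Space n → ℝ≥0∞ := {x : Space n | ‖x‖ ≤ ε}.indicator 1 with hI
  have hIm : Measurable I := measurable_one.indicator (measurableSet_le (by fun_prop) (by fun_prop))
  have hI1 : ∀ x, I x ≤ 1 := fun x => Set.indicator_le_self' (by simp) _
  have hpt : ∀ z : Space n × Space n, A z.1 * B (rot n s z).1 ≤
      invSq z.1 * invSq (rot n s z).1 * (‖a (dir z.1)‖ₑ * ‖b (dir (rot n s z).1)‖ₑ) +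
      2 * C ^ 2 * (I z.1 * invSq z.1 * invSq (rot n s z).1) +
      2 * C ^ 2 * (I (rot n s z).1 * invSq (rot n s z).1 * invSq z.1) := by
    intro z
    set x := z.1
    set y := (rot n s z).1
    set u := ‖a (dir x)‖ₑ
    set v := ‖b (dir y)‖ₑ
    -- Every term except `u * v` carries an indicator of the ball; the term with two indicators is
    -- absorbed by dropping the one at `y`.
    calc A x * B y ≤ (invSq x * (u + C * I x)) * (invSq y * (v + C * I y)) :=
          mul_le_mul' (hA x) (hB y)
      _ = invSq x * invSq y * (u * v + C * I x * v + u * (C * I y) + C * I x * (C * I y)) := by ring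
      _ ≤ invSq x * invSq y * (u * v + C * I x * C + C * (C * I y) + C * I x * (C * 1)) := by
          gcongr
          · exact hbC _
          · exact haC _
          · exact hI1 _
      _ = invSq x * invSq y * (u * v) + 2 * C ^ 2 * (I x * invSq x * invSq y) +
          1 * C ^ 2 * (I y * invSq y * invSq x) := by ring
      _ ≤ _ := by gcongr; norm_num
  have hE := lintegral_invSq_mul_le hn s hIm
  have hE' : ∫⁻ p, I (rot n s p).1 * invSq (rot n s p).1 * invSq p.1 ∂(gaussPair n) =
      ∫⁻ p, I p.1 * invSq p.1 * invSq (rot n s p).1 ∂(gaussPair n) := by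
    rw [← lintegral_rot s (by fun_prop)]
    simp_rw [rot_rot]
  calc _ ≤ _ := lintegral_mono hpt
    _ = ∫⁻ z, invSq z.1 * invSq (rot n s z).1 * (‖a (dir z.1)‖ₑ * ‖b (dir (rot n s z).1)‖ₑ)
          ∂(gaussPair n) +
        2 * C ^ 2 * (∫⁻ p, I p.1 * invSq p.1 * invSq (rot n s p).1 ∂(gaussPair n)) +
        2 * C ^ 2 * (∫⁻ p, I p.1 * invSq p.1 * invSq (rot n s p).1 ∂(gaussPair n)) := by
        rw [lintegral_add_right _ (by fun_prop), lintegral_add_right _ (by fun_prop),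
          lintegral_const_mul _ (by fun_prop), lintegral_const_mul _ (by fun_prop), hE']
    _ ≤ invFourth n * (eLpNorm a p (sigma n) * eLpNorm b q (sigma n)) +
        2 * C ^ 2 * smallBall n ε + 2 * C ^ 2 * smallBall n ε := by
        gcongr
        exacts [lintegral_dir_mul_dir_le hn s ha hb, hE, hE]
    _ = _ := by ring

end SphereCov

namespace SphereCov

/-! ### Homogeneous extensions -/

variable {n : ℕ}

lemma IsC2.continuous [NeZero n] {f : Sphere n → ℝ} (hf : IsC2 f) : Continuous f := by
  have : Fact (Module.finrank ℝ (Space n) = n - 1 + 1) :=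
    ⟨by rw [finrank_euclideanSpace_fin]; have := NeZero.pos n; omega⟩
  have h : ContMDiff (𝓡 (n - 1)) 𝓘(ℝ, ℝ) 2 f := hf
  exact h.continuous

/-- The extension by homogeneity of degree zero is `C²`-smooth away from the origin. -/
lemma IsC2.contDiffAt_dir [NeZero n] {f : Sphere n → ℝ} (hf : IsC2 f) {x : Space n} (hx : x ≠ 0) :
    ContDiffAt ℝ 2 (fun x => f (dir x)) x := by
  have : Fact (Module.finrank ℝ (Space n) = n - 1 + 1) :=
    ⟨by rw [finrank_euclideanSpace_fin]; have := NeZero.pos n; omega⟩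
  let U : TopologicalSpace.Opens (Space n) := ⟨{0}ᶜ, isOpen_compl_singleton⟩
  have hU : ∀ y : U, (y : Space n) ≠ 0 := fun y => y.2
  have h1 : ContMDiff 𝓘(ℝ, Space n) 𝓘(ℝ, Space n) 2 fun y : U => (dir (y : Space n) : Space n) := by
    intro y
    refine (contMDiffAt_subtype_iff (f := fun y : Space n => (dir y : Space n)) (U := U)).2 ?_
    rw [contMDiffAt_iff_contDiffAt]
    have : ContDiffAt ℝ 2 (fun y : Space n => ‖y‖⁻¹ • y) y :=
      ((contDiffAt_norm ℝ (hU y)).inv (by simpa using hU y)).smul contDiffAt_id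
    refine this.congr_of_eventuallyEq ?_
    filter_upwards [isOpen_compl_singleton.mem_nhds (hU y)] with z hz
    exact coe_dir hz
  -- The normalization is smooth as a map into the manifold, so composing it with `f` transfers
  -- smoothness from the sphere to the punctured space.
  have h2 := ContMDiff.codRestrict_sphere (n := n - 1) h1 fun y => (dir (y : Space n)).2
  have h3 := hf.comp h2
  have h4 := h3 ⟨x, hx⟩
  exact contMDiffAt_iff_contDiffAt.1
    ((contMDiffAt_subtype_iff (f := fun y : Space n => f (dir y)) (U := U) (x := ⟨x, hx⟩)).1 h4)

/-- `F` is homogeneous of degree zero and `C²`-smooth away from the origin. -/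
structure IsHomog (F : Space n → ℝ) : Prop where
  contDiffAt : ∀ {x}, x ≠ 0 → ContDiffAt ℝ 2 F x
  smul : ∀ {t : ℝ}, 0 < t → ∀ x, F (t • x) = F x

lemma IsC2.isHomog [NeZero n] {f : Sphere n → ℝ} (hf : IsC2 f) :
    IsHomog fun x : Space n => f (dir x) where
  contDiffAt := hf.contDiffAt_dir
  smul ht x := by
    by_cases hx : x = 0
    · simp [hx]
    · rw [dir_smul ht hx]

/-- The matrix of second order partial derivatives. -/
noncomputable def hessMat (F : Space n → ℝ) (x : Space n) : Matrix (Fin n) (Fin n) ℝ :=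
  .of fun i j => pderiv j (pderiv i F) x

lemma pderiv_congr {F G : Space n → ℝ} {x : Space n} (h : F =ᶠ[𝓝 x] G) (i : Fin n) :
    pderiv i F =ᶠ[𝓝 x] pderiv i G := by
  filter_upwards [h.fderiv (𝕜 := ℝ)] with y hy
  simp [pderiv, hy]

lemma hessMat_congr {F G : Space n → ℝ} {x : Space n} (h : F =ᶠ[𝓝 x] G) :
    hessMat F x = hessMat G x := by
  ext i j
  exact (pderiv_congr (pderiv_congr h i) j).self_of_nhds

lemma pderiv_comp_smul (F : Space n → ℝ) (t : ℝ) (i : Fin n) (x : Space n) :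
    pderiv i (fun y => F (t • y)) x = t * pderiv i F (t • x) := by
  simp [pderiv, fderiv_comp_smul]

lemma pderiv_const_mul (F : Space n → ℝ) (t : ℝ) (i : Fin n) (x : Space n) :
    pderiv i (fun y => t * F y) x = t * pderiv i F x := by
  simp only [pderiv]
  rw [show (fun y => t * F y) = t • F from rfl, fderiv_const_smul_field]
  simp

lemma hessMat_comp_smul (F : Space n → ℝ) (t : ℝ) (x : Space n) :
    hessMat (fun y => F (t • y)) x = t ^ 2 • hessMat F (t • x) := by
  ext i j
  have : pderiv i (fun y => F (t • y)) = fun x => t * pderiv i F (t • x) :=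
    funext fun x => pderiv_comp_smul F t i x
  simp only [hessMat, Matrix.of_apply, Matrix.smul_apply, smul_eq_mul]
  rw [this, pderiv_const_mul (fun y => pderiv i F (t • y)), pderiv_comp_smul]
  ring

lemma hsNorm_smul (t : ℝ) (A : Matrix (Fin n) (Fin n) ℝ) : hsNorm (t • A) = |t| * hsNorm A := by
  simp only [hsNorm, Matrix.smul_apply, smul_eq_mul, mul_pow, ← Finset.mul_sum]
  rw [Real.sqrt_mul (sq_nonneg t), Real.sqrt_sq_eq_abs]

lemma hsNorm_nonneg (A : Matrix (Fin n) (Fin n) ℝ) : 0 ≤ hsNorm A := Real.sqrt_nonneg _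

lemma contDiffAt_pderiv {F : Space n → ℝ} {x : Space n} {m k : WithTop ℕ∞}
    (h : ContDiffAt ℝ k F x) (hk : m + 1 ≤ k) (i : Fin n) : ContDiffAt ℝ m (pderiv i F) x :=
  (h.fderiv_right hk).clm_apply contDiffAt_const

lemma continuousAt_hsNorm_hessMat {F : Space n → ℝ} {x : Space n}
    (h : ContDiffAt ℝ 2 F x) : ContinuousAt (fun x => hsNorm (hessMat F x)) x := by
  have : ∀ i j, ContinuousAt (pderiv j (pderiv i F)) x := fun i j =>
    ContDiffAt.continuousAt (n := 0)
      (contDiffAt_pderiv (k := 1) (contDiffAt_pderiv h (by norm_num) i) (by norm_num) j)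
  unfold hsNorm
  refine ContinuousAt.sqrt (tendsto_finsetSum _ fun i _ => tendsto_finsetSum _ fun j _ => ?_)
  exact (this i j).pow 2

lemma BddC1.const_mul {F : Space n → ℝ} (hF : BddC1 F) (t : ℝ) : BddC1 fun x => t * F x := by
  refine ⟨contDiff_const.mul hF.contDiff, ?_, ?_⟩
  · obtain ⟨C, hC⟩ := hF.bdd
    exact ⟨|t| * C, fun x => by
      rw [abs_mul]; exact mul_le_mul_of_nonneg_left (hC x) (abs_nonneg t)⟩
  · obtain ⟨C, hC⟩ := hF.bdd_fderiv
    refine ⟨|t| * C, fun x => ?_⟩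
    rw [show (fun y => t * F y) = t • F from rfl, fderiv_const_smul_field, Pi.smul_apply, norm_smul]
    exact mul_le_mul_of_nonneg_left (hC x) (abs_nonneg t)

/-- A continuous function which is homogeneous of nonpositive degree outside of the unit ball is
bounded. -/
lemma exists_norm_le_of_homog [NeZero n] {E : Type*} [NormedAddCommGroup E] [NormedSpace ℝ E]
    {h h₀ : Space n → E} (k : ℕ) (hc : Continuous h)
    (hc₀ : ∀ x, x ≠ 0 → ContinuousAt h₀ x) (heq : ∀ x, 1 < ‖x‖ → h x = h₀ x)
    (hh : ∀ t : ℝ, 0 < t → ∀ x, x ≠ 0 → h₀ (t • x) = (t⁻¹) ^ k • h₀ x) :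
    ∃ C, ∀ x, ‖h x‖ ≤ C := by
  obtain ⟨C₁, h₁⟩ := (isCompact_closedBall (0 : Space n) 1).exists_bound_of_continuousOn
    hc.continuousOn
  obtain ⟨C₂, h₂⟩ := (isCompact_sphere (0 : Space n) 1).exists_bound_of_continuousOn (f := h₀)
    fun x hx => (hc₀ x (ne_zero_of_mem_unit_sphere ⟨x, hx⟩)).continuousWithinAt
  refine ⟨max C₁ C₂, fun x => ?_⟩
  rcases le_or_gt ‖x‖ 1 with hx | hx
  · exact (h₁ x (by simpa using hx)).trans (le_max_left _ _)
  · refine le_trans ?_ (le_max_right _ _)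
    have hd := h₂ (dir x) (dir x).2
    rw [heq x hx, ← norm_smul_dir x, hh _ (by positivity) _ (ne_zero_of_mem_unit_sphere _),
      norm_smul]
    refine (mul_le_of_le_one_left (norm_nonneg _) ?_).trans hd
    rw [norm_pow, norm_inv, norm_norm]
    exact pow_le_one₀ (by positivity) (inv_le_one_of_one_le₀ hx.le)

/-! ### Removing the singularity at the origin. -/

/-- A smooth radial function vanishing near zero and equal to one outside of the unit ball. -/
noncomputable def cutoff (x : Space n) : ℝ := Real.smoothTransition (2 * ‖x‖ ^ 2 - 1)

lemma contDiff_cutoff {k : ℕ∞} : ContDiff ℝ k (cutoff (n := n)) :=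
  Real.smoothTransition.contDiff.comp ((contDiff_const.mul (contDiff_norm_sq ℝ)).sub contDiff_const)

lemma cutoff_of_one_le {x : Space n} (hx : 1 ≤ ‖x‖) : cutoff x = 1 :=
  Real.smoothTransition.one_of_one_le (by nlinarith)

lemma cutoff_eventuallyEq_zero : cutoff =ᶠ[𝓝 (0 : Space n)] 0 := by
  filter_upwards [Metric.ball_mem_nhds (0 : Space n) (by norm_num : (0 : ℝ) < 1 / 2)] with x hx
  refine Real.smoothTransition.zero_of_nonpos ?_
  have : ‖x‖ < 1 / 2 := by simpa using hx
  nlinarith [norm_nonneg x]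

/-- The homogeneous function `F` cut off near the origin. -/
noncomputable def cut (F : Space n → ℝ) (x : Space n) : ℝ := cutoff x * F x

lemma cut_eventuallyEq {F : Space n → ℝ} {x : Space n} (hx : 1 < ‖x‖) : cut F =ᶠ[𝓝 x] F := by
  filter_upwards [(isOpen_lt continuous_const continuous_norm).mem_nhds hx] with y hy
  simp [cut, cutoff_of_one_le (le_of_lt hy)]

lemma cut_eventuallyEq_zero {F : Space n → ℝ} : cut F =ᶠ[𝓝 0] fun _ => 0 := by
  filter_upwards [cutoff_eventuallyEq_zero] with y hy
  simp [cut, hy]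

namespace IsHomog

variable {F : Space n → ℝ}

lemma contDiff_cut (hF : IsHomog F) : ContDiff ℝ 2 (cut F) := by
  rw [contDiff_iff_contDiffAt]
  intro x
  by_cases hx : x = 0
  · rw [hx]
    exact contDiffAt_const.congr_of_eventuallyEq cut_eventuallyEq_zero
  · exact (contDiff_cutoff (k := 2)).contDiffAt.mul (hF.contDiffAt hx)

/-- Differentiating the identity `F(t x) = F(x)` in `x` lowers the degree of homogeneity by one; the
next lemmas repeat this for second derivatives. -/
lemma fderiv_smul (hF : IsHomog F) {t : ℝ} (ht : 0 < t) (x : Space n) :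
    fderiv ℝ F (t • x) = t⁻¹ • fderiv ℝ F x := by
  have h : fderiv ℝ (fun y => F (t • y)) x = t • fderiv ℝ F (t • x) := fderiv_comp_smul ..
  rw [show (fun y => F (t • y)) = F from funext (hF.smul ht)] at h
  rw [h, smul_smul, inv_mul_cancel₀ ht.ne', one_smul]

lemma pderiv_smul (hF : IsHomog F) {t : ℝ} (ht : 0 < t) (i : Fin n) (x : Space n) :
    pderiv i F (t • x) = t⁻¹ * pderiv i F x := by
  simp [pderiv, hF.fderiv_smul ht]

lemma fderiv_pderiv_smul (hF : IsHomog F) {t : ℝ} (ht : 0 < t) (i : Fin n) (x : Space n) :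
    fderiv ℝ (pderiv i F) (t • x) = (t⁻¹) ^ 2 • fderiv ℝ (pderiv i F) x := by
  have h : fderiv ℝ (fun y => pderiv i F (t • y)) x = t • fderiv ℝ (pderiv i F) (t • x) :=
    fderiv_comp_smul ..
  rw [show (fun y => pderiv i F (t • y)) = t⁻¹ • pderiv i F from
    funext (hF.pderiv_smul ht i), fderiv_const_smul_field] at h
  rw [Pi.smul_apply] at h
  rw [sq, mul_smul, h, smul_smul, inv_mul_cancel₀ ht.ne', one_smul]

lemma hessMat_smul (hF : IsHomog F) {t : ℝ} (ht : 0 < t) (x : Space n) :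
    hessMat F (t • x) = (t⁻¹) ^ 2 • hessMat F x := by
  ext i j
  have := congrArg (fun L => L (EuclideanSpace.single j (1 : ℝ))) (hF.fderiv_pderiv_smul ht i x)
  simpa [hessMat, pderiv] using this

lemma bddC1_cut [NeZero n] (hF : IsHomog F) : BddC1 (cut F) where
  contDiff := hF.contDiff_cut.of_le (by norm_num)
  bdd := exists_norm_le_of_homog (h₀ := F) 0 hF.contDiff_cut.continuous
    (fun x hx => (hF.contDiffAt hx).continuousAt) (fun x hx => (cut_eventuallyEq hx).self_of_nhds)
    (fun t ht x _ => by simpa using hF.smul ht x)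
  bdd_fderiv := exists_norm_le_of_homog (h₀ := fderiv ℝ F) 1
    (hF.contDiff_cut.continuous_fderiv two_ne_zero)
    (fun x hx => ((hF.contDiffAt hx).fderiv_right (m := 1) (by norm_num)).continuousAt)
    (fun x hx => (cut_eventuallyEq hx).fderiv_eq)
    (fun t ht x _ => by simpa using hF.fderiv_smul ht x)

lemma bddC1_pderiv_cut [NeZero n] (hF : IsHomog F) (i : Fin n) : BddC1 (pderiv i (cut F)) where
  contDiff := contDiff_iff_contDiffAt.2 fun x =>
    contDiffAt_pderiv hF.contDiff_cut.contDiffAt (by norm_num) i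
  bdd := hF.bddC1_cut.bdd_pderiv i
  bdd_fderiv := exists_norm_le_of_homog (h₀ := fderiv ℝ (pderiv i F)) 2
    (ContDiff.continuous_fderiv (n := 1) (contDiff_iff_contDiffAt.2 fun x =>
      contDiffAt_pderiv hF.contDiff_cut.contDiffAt (by norm_num) i) one_ne_zero)
    (fun x hx => ((contDiffAt_pderiv (m := 1) (hF.contDiffAt hx) (by norm_num) i).fderiv_right
      (m := 0) (by norm_num)).continuousAt)
    (fun x hx => (pderiv_congr (cut_eventuallyEq hx) i).fderiv_eq)
    (fun t ht x _ => hF.fderiv_pderiv_smul ht i x)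

/-- Since `F` is invariant under dilations, `cut F (R • x)` equals `F` outside the ball of radius
`1/R`: rescaling the argument shrinks the cut-off region. -/
lemma bddC1_cut_smul [NeZero n] (hF : IsHomog F) (R : ℝ) : BddC1 fun x => cut F (R • x) := by
  simpa using (hF.bddC1_cut.comp_affine 0 R).1

lemma bddC1_pderiv_cut_smul [NeZero n] (hF : IsHomog F) (R : ℝ) (i : Fin n) :
    BddC1 (pderiv i fun x => cut F (R • x)) := by
  have h := ((hF.bddC1_pderiv_cut i).comp_affine 0 R).1.const_mul R
  simp only [zero_add] at h
  rwa [show pderiv i (fun x => cut F (R • x)) = fun x => R * pderiv i (cut F) (R • x) from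
    funext fun x => pderiv_comp_smul _ R i x]

lemma continuous_hsNorm_hessMat_coe (hF : IsHomog F) :
    Continuous fun θ : Sphere n => hsNorm (hessMat F θ) := by
  rw [continuous_iff_continuousAt]
  intro θ
  exact (continuousAt_hsNorm_hessMat
    (hF.contDiffAt (ne_zero_of_mem_unit_sphere θ))).comp continuous_subtype_val.continuousAt

/-- The Hessian of a homogeneous function cut off in a ball. -/
lemma exists_hsNorm_hessMat_cut_le [NeZero n] (hF : IsHomog F) :
    ∃ C : ℝ, (∀ θ : Sphere n, hsNorm (hessMat F θ) ≤ C) ∧ ∀ R : ℝ, 0 < R → ∀ x,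
      ‖hsNorm (hessMat (fun x => cut F (R • x)) x)‖ₑ ≤ invSq x * (‖hsNorm (hessMat F (dir x))‖ₑ +
        ENNReal.ofReal C * {x : Space n | ‖x‖ ≤ 1 / R}.indicator 1 x) := by
  obtain ⟨C₁, h₁⟩ := exists_norm_le_of_homog (h := fun x => hsNorm (hessMat (cut F) x))
    (h₀ := fun x => hsNorm (hessMat F x)) 2
    (continuous_iff_continuousAt.2 fun x =>
      continuousAt_hsNorm_hessMat hF.contDiff_cut.contDiffAt)
    (fun x hx => continuousAt_hsNorm_hessMat (hF.contDiffAt hx))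
    (fun x hx => by simp only [hessMat_congr (cut_eventuallyEq hx)])
    (fun t ht x _ => by
      simp only [hF.hessMat_smul ht, hsNorm_smul, smul_eq_mul]
      rw [abs_of_nonneg (by positivity)])
  obtain ⟨C₂, h₂⟩ := (isCompact_univ (X := Sphere n)).exists_bound_of_continuousOn
    hF.continuous_hsNorm_hessMat_coe.continuousOn
  refine ⟨max C₁ C₂, fun θ => (le_abs_self _).trans ((h₂ θ (Set.mem_univ _)).trans
    (le_max_right _ _)), fun R hR x => ?_⟩
  have hC0 : 0 ≤ max C₁ C₂ := (norm_nonneg _).trans ((h₁ 0).trans (le_max_left _ _))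
  rw [hessMat_comp_smul, hsNorm_smul, abs_of_nonneg (by positivity)]
  -- With the convention `0⁻¹ = 0` the weight `invSq` vanishes at the origin, so the left side must
  -- vanish there; it does, as `cut F` is zero near the origin.
  by_cases hx : x = 0
  · have : hessMat (cut F) (R • x) = 0 := by
      rw [hx, smul_zero, hessMat_congr cut_eventuallyEq_zero]
      have h0 : ∀ i : Fin n, pderiv i (fun _ : Space n => (0 : ℝ)) = fun _ => 0 := fun i =>
        funext fun y => by simp [pderiv]
      ext i j
      simp [hessMat, h0]
    simp [this, hsNorm]
  have hx0 : 0 < ‖x‖ := norm_pos_iff.2 hx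
  rcases le_or_gt ‖x‖ (1 / R) with hxR | hxR
  -- Inside the ball the Hessian is at most `R² C₁`, and `R ≤ |x|⁻¹` there.
  · rw [Set.indicator_of_mem (show x ∈ {x : Space n | ‖x‖ ≤ 1 / R} from hxR), Pi.one_apply, mul_one]
    refine le_trans ?_ (mul_le_mul_right (le_add_of_nonneg_left (zero_le)) _)
    rw [invSq, ← ENNReal.ofReal_mul (by positivity), Real.enorm_eq_ofReal_abs]
    refine ENNReal.ofReal_le_ofReal ?_
    rw [abs_mul, abs_of_nonneg (by positivity : (0 : ℝ) ≤ R ^ 2)]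
    refine mul_le_mul ?_ ((h₁ _).trans (le_max_left _ _)) (abs_nonneg _) (by positivity)
    gcongr
    rw [le_inv_comm₀ hR hx0]
    simpa using hxR
  · have h1 : 1 < ‖R • x‖ := by
      rw [norm_smul, Real.norm_of_nonneg hR.le]
      rwa [div_lt_iff₀ hR, mul_comm] at hxR
    -- Outside the ball the cut-off is inactive, and homogeneity of degree `-2` gives the bound with
    -- equality.
    rw [hessMat_congr (cut_eventuallyEq h1)]
    refine le_trans (le_of_eq ?_) (mul_le_mul_right (le_add_of_nonneg_right (zero_le)) _)
    rw [hF.hessMat_smul hR]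
    conv_lhs => rw [← norm_smul_dir x, hF.hessMat_smul hx0]
    rw [hsNorm_smul, hsNorm_smul, abs_of_nonneg (by positivity), abs_of_nonneg (by positivity),
      ← mul_assoc, ← mul_pow, mul_inv_cancel₀ hR.ne', one_pow, one_mul, enorm_mul, invSq,
      Real.enorm_of_nonneg (by positivity)]

end IsHomog

end SphereCov

namespace SphereCov

variable {n : ℕ}

/-! ### The Hilbert-Schmidt norm -/

lemma hsNorm_eq_norm (A : Matrix (Fin n) (Fin n) ℝ) :
    hsNorm A = ‖(WithLp.toLp 2 fun p : Fin n × Fin n => A p.1 p.2 :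
      EuclideanSpace ℝ (Fin n × Fin n))‖ := by
  simp [hsNorm, EuclideanSpace.norm_eq, Fintype.sum_prod_type]

lemma hsNorm_add_le (A B : Matrix (Fin n) (Fin n) ℝ) : hsNorm (A + B) ≤ hsNorm A + hsNorm B := by
  simp only [hsNorm_eq_norm]
  exact norm_add_le (WithLp.toLp 2 fun p : Fin n × Fin n => A p.1 p.2 :
    EuclideanSpace ℝ (Fin n × Fin n)) (WithLp.toLp 2 fun p : Fin n × Fin n => B p.1 p.2)

lemma abs_sum_mul_le_hsNorm (A B : Matrix (Fin n) (Fin n) ℝ) :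
    |∑ i, ∑ j, A i j * B i j| ≤ hsNorm A * hsNorm B := by
  have := abs_real_inner_le_norm (WithLp.toLp 2 fun p : Fin n × Fin n => B p.1 p.2 :
    EuclideanSpace ℝ (Fin n × Fin n)) (WithLp.toLp 2 fun p : Fin n × Fin n => A p.1 p.2)
  rw [hsNorm_eq_norm, hsNorm_eq_norm, mul_comm]
  simpa [PiLp.inner_apply, Fintype.sum_prod_type] using this

lemma hsNorm_vecMulVec (x y : Space n) : hsNorm (vecMulVec x.ofLp y.ofLp) = ‖x‖ * ‖y‖ := by
  simp only [hsNorm, vecMulVec_apply, mul_pow, EuclideanSpace.norm_eq, Real.norm_eq_abs, sq_abs]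
  rw [← Real.sqrt_mul (Finset.sum_nonneg fun _ _ => sq_nonneg _), Finset.sum_mul_sum]

/-- A symmetric matrix acting on the orthogonal complement of `θ` has the least norm among those
with the same quadratic form there. -/
lemma hsNorm_le_hsNorm_add {A D : Matrix (Fin n) (Fin n) ℝ} (hA : A.IsSymm) (hD : D.IsSymm)
    {θ : Fin n → ℝ} (hθ : θ ⬝ᵥ θ = 1) (hAθ : A *ᵥ θ = 0)
    (hv : ∀ v, θ ⬝ᵥ v = 0 → (D *ᵥ v) ⬝ᵥ v = 0) : hsNorm A ≤ hsNorm (A + D) := by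
  -- Polarization: the bilinear form of `D` also vanishes on pairs of vectors orthogonal to `θ`.
  have hpol : ∀ u v, θ ⬝ᵥ u = 0 → θ ⬝ᵥ v = 0 → u ⬝ᵥ (D *ᵥ v) = 0 := by
    intro u v hu hv'
    have h1 := hv (u + v) (by simp [dotProduct_add, hu, hv'])
    have h2 : v ⬝ᵥ (D *ᵥ u) = u ⬝ᵥ (D *ᵥ v) := by
      rw [dotProduct_mulVec, ← mulVec_transpose, hD.eq, dotProduct_comm]
    simp only [mulVec_add, dotProduct_add, add_dotProduct, hv u hu, hv v hv'] at h1
    rw [dotProduct_comm (D *ᵥ u), dotProduct_comm (D *ᵥ v), h2] at h1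
    linarith
  -- `A` and `D` are Hilbert-Schmidt orthogonal: `A` lives on the complement of `θ`, where `D`
  -- vanishes. The claim is then Pythagoras' theorem.
  have hcross : ∑ i, ∑ j, A i j * D i j = 0 := by
    have hcol : ∀ j, θ ⬝ᵥ A j = 0 := by
      intro j
      rw [dotProduct_comm]
      exact congrFun hAθ j
    -- Polarization is applied to the `j`-th row of `A` and to the tangential part `e_j - θ_j θ` of
    -- the basis vector.
    have h1 : ∀ j, A j ⬝ᵥ (D *ᵥ Pi.single j 1) = θ j * (A j ⬝ᵥ (D *ᵥ θ)) := by
      intro j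
      have := hpol (A j) (Pi.single j 1 - θ j • θ) (hcol j)
        (by simp [dotProduct_sub, hθ])
      rw [mulVec_sub, mulVec_smul, dotProduct_sub, dotProduct_smul, smul_eq_mul] at this
      linarith
    have h2 : ∀ j, A j ⬝ᵥ (D *ᵥ Pi.single j 1) = ∑ i, A j i * D j i := by
      intro j
      rw [mulVec_single_one]
      exact Finset.sum_congr rfl fun i _ => by rw [col_apply, hD.apply]
    calc ∑ i, ∑ j, A i j * D i j = ∑ i, θ i * (A i ⬝ᵥ (D *ᵥ θ)) :=
          Finset.sum_congr rfl fun i _ => by rw [← h2, h1]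
      _ = θ ⬝ᵥ (A *ᵥ (D *ᵥ θ)) := rfl
      _ = 0 := by rw [dotProduct_mulVec, ← mulVec_transpose, hA.eq, hAθ, zero_dotProduct]
  refine Real.sqrt_le_sqrt ?_
  have : ∑ i, ∑ j, (A + D) i j ^ 2 =
      ∑ i, ∑ j, A i j ^ 2 + 2 * ∑ i, ∑ j, A i j * D i j + ∑ i, ∑ j, D i j ^ 2 := by
    simp only [Matrix.add_apply, Finset.mul_sum, ← Finset.sum_add_distrib]
    exact Finset.sum_congr rfl fun i _ => Finset.sum_congr rfl fun j _ => by ring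
  rw [this, hcross]
  have : 0 ≤ ∑ i, ∑ j, D i j ^ 2 :=
    Finset.sum_nonneg fun _ _ => Finset.sum_nonneg fun _ _ => sq_nonneg _
  linarith

/-! ### Taylor expansions -/

/-- The second order Taylor expansion of a `C²`-smooth function. -/
lemma taylor_two_isLittleO {E : Type*} [NormedAddCommGroup E] [NormedSpace ℝ E] {F : E → ℝ} {x : E}
    (hF : ContDiffAt ℝ 2 F x) :
    (fun y => F y - F x - fderiv ℝ F x (y - x) - 1 / 2 * fderiv ℝ (fderiv ℝ F) x (y - x) (y - x))
      =o[𝓝 x] fun y => ‖y - x‖ ^ 2 := by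
  set D := fderiv ℝ (fderiv ℝ F) x with hD
  have hsymm : ∀ v w, D v w = D w v := hF.isSymmSndFDerivAt (by simp)
  have hd : HasFDerivAt (fderiv ℝ F) D x :=
    ((hF.fderiv_right (m := 1) (by norm_num)).differentiableAt one_ne_zero).hasFDerivAt
  have hdiff : ∀ᶠ y in 𝓝 x, DifferentiableAt ℝ F y :=
    (hF.eventually (by simp)).mono fun y hy => hy.differentiableAt two_ne_zero
  rw [isLittleO_iff]
  intro ε hε
  have h1 := (hasFDerivAt_iff_isLittleO.1 hd).def hε
  obtain ⟨δ, hδ, hball⟩ := Metric.eventually_nhds_iff_ball.1 (h1.and hdiff)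
  filter_upwards [Metric.ball_mem_nhds x hδ] with y hy
  -- The derivative of the remainder is the first-order error of `fderiv ℝ F`, at most `ε |z - x|`;
  -- the mean value inequality then bounds `R y` by `ε |y - x|²`.
  set R : E → ℝ := fun z => F z - F x - fderiv ℝ F x (z - x) - 1 / 2 * D (z - x) (z - x) with hR
  have hsub : ∀ z ∈ Metric.closedBall x ‖y - x‖, z ∈ Metric.ball x δ := by
    intro z hz
    rw [Metric.mem_ball, dist_eq_norm] at hy ⊢
    rw [Metric.mem_closedBall, dist_eq_norm] at hz
    exact hz.trans_lt hy
  have hRd : ∀ z ∈ Metric.closedBall x ‖y - x‖,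
      HasFDerivAt R (fderiv ℝ F z - fderiv ℝ F x - D (z - x)) z := by
    intro z hz
    have e0 : HasFDerivAt (fun z => z - x) (ContinuousLinearMap.id ℝ E) z :=
      (hasFDerivAt_id z).sub_const x
    have e1 := ((hball z (hsub z hz)).2.hasFDerivAt.sub_const (F x)).sub
      ((fderiv ℝ F x).hasFDerivAt.comp z e0)
    have e2 := (D.hasFDerivAt.comp z e0).clm_apply e0
    refine (e1.sub (e2.const_mul (1 / 2))).congr_fderiv ?_
    ext v
    have h := hsymm v (z - x)
    simp only [map_sub, _root_.sub_apply] at h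
    simp
    linarith
  have := (convex_closedBall x ‖y - x‖).norm_image_sub_le_of_norm_hasFDerivWithin_le
    (f := R) (C := ε * ‖y - x‖) (fun z hz => (hRd z hz).hasFDerivWithinAt) (fun z hz => by
      refine (hball z (hsub z hz)).1.trans ?_
      rw [Metric.mem_closedBall, dist_eq_norm] at hz
      gcongr) (x := x) (y := y) (Metric.mem_closedBall_self (norm_nonneg _))
    (by rw [Metric.mem_closedBall, dist_eq_norm])
  have hR0 : R x = 0 := by simp [hR]
  rw [hR0, sub_zero, mul_assoc, ← sq] at this
  rwa [norm_pow, norm_norm]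

/-- Every tangent vector is the velocity of a curve on the sphere. -/
lemma exists_curve (θ : Sphere n) {v : Space n} (hv : ⟪(θ : Space n), v⟫_ℝ = 0) :
    ∃ c : ℝ → Sphere n, Filter.Tendsto c (𝓝[≠] 0) (𝓝 θ) ∧
      Filter.Tendsto (fun t => t⁻¹ • ((c t : Space n) - θ)) (𝓝[≠] 0) (𝓝 v) := by
  by_cases hv0 : v = 0
  · exact ⟨fun _ => θ, tendsto_const_nhds, by simp [hv0]⟩
  have hv1 : ‖v‖ ≠ 0 := by simpa using hv0
  set u := ‖v‖⁻¹ • v with hu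
  have hun : ‖u‖ = 1 := by simp [hu, norm_smul, hv1]
  have hθ : ‖(θ : Space n)‖ = 1 := by simp
  have huθ : ⟪(θ : Space n), u⟫_ℝ = 0 := by simp [hu, real_inner_smul_right, hv]
  -- The great circle through `θ` with initial velocity `v`.
  set γ : ℝ → Space n := fun t => Real.cos (‖v‖ * t) • (θ : Space n) + Real.sin (‖v‖ * t) • u with hγ
  have hγ1 : ∀ t, γ t ∈ Metric.sphere (0 : Space n) 1 := by
    intro t
    have : ‖γ t‖ ^ 2 = 1 := by
      rw [hγ]
      simp only [norm_add_sq_real, norm_smul, mul_pow, real_inner_smul_left, real_inner_smul_right,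
        huθ, hun, hθ, Real.norm_eq_abs, sq_abs]
      linear_combination Real.cos_sq_add_sin_sq (‖v‖ * t)
    simpa using (pow_eq_one_iff_of_nonneg (norm_nonneg _) two_ne_zero).1 this
  have hγ0 : γ 0 = θ := by simp [hγ]
  have hd : HasDerivAt γ v 0 := by
    have e : HasDerivAt (fun t : ℝ => ‖v‖ * t) (‖v‖ * 1) 0 := (hasDerivAt_id 0).const_mul ‖v‖
    have := (e.cos.smul_const (θ : Space n)).add (e.sin.smul_const u)
    refine this.congr_deriv ?_
    simp [hu, smul_smul, hv1]
  refine ⟨fun t => ⟨γ t, hγ1 t⟩, ?_, ?_⟩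
  · refine tendsto_subtype_rng.2 ?_
    have := hd.continuousAt.tendsto.mono_left (nhdsWithin_le_nhds (s := {0}ᶜ))
    rwa [hγ0] at this
  · have := hd.tendsto_slope_zero
    simpa [hγ0] using this

/-- A form of degree `k` which is negligible along the sphere vanishes on tangent vectors. -/
lemma eq_zero_of_isLittleO_sphere (θ : Sphere n) {Q : Space n → ℝ} (k : ℕ) (hQ : Continuous Q)
    (hk : ∀ (t : ℝ) x, Q (t • x) = t ^ k * Q x)
    (ho : (fun θ' : Sphere n => Q ((θ' : Space n) - θ)) =o[𝓝 θ]
      fun θ' : Sphere n => ‖(θ' : Space n) - θ‖ ^ k)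
    {v : Space n} (hv : ⟪(θ : Space n), v⟫_ℝ = 0) : Q v = 0 := by
  obtain ⟨c, hc, hcv⟩ := exists_curve θ hv
  -- Multiplying by `t⁻ᵏ` along the curve gives `Q` at the difference quotient, which converges to
  -- `v`; the smallness of `Q` forces the limit to be zero.
  have h1 := (isBigO_refl (fun t : ℝ => (t⁻¹) ^ k) (𝓝[≠] 0)).mul_isLittleO (ho.comp_tendsto hc)
  have h2 : (fun t => Q (t⁻¹ • ((c t : Space n) - θ))) =o[𝓝[≠] 0]
      fun t => ‖t⁻¹ • ((c t : Space n) - θ)‖ ^ k := by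
    refine (h1.congr_left fun t => ?_).trans_isBigO ?_
    · simp only [Function.comp_apply, hk]
    · refine IsBigO.of_bound 1 (.of_forall fun t => ?_)
      simp [norm_smul, mul_pow]
  have h3 : (fun t => ‖t⁻¹ • ((c t : Space n) - θ)‖ ^ k) =O[𝓝[≠] 0] fun _ => (1 : ℝ) :=
    (hcv.norm.pow k).isBigO_one ℝ
  have h4 := (isLittleO_one_iff ℝ).1 (h2.trans_isBigO h3)
  exact tendsto_nhds_unique ((hQ.tendsto v).comp hcv) h4

/-! ### The spherical gradient and Hessian in terms of the homogeneous extension -/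

/-- Euler's identity. -/
lemma fderiv_apply_self_of_homog {G : Space n → ℝ} {x : Space n} (hG : DifferentiableAt ℝ G x)
    (k : ℕ) (hk : ∀ t : ℝ, 0 < t → G (t • x) = (t⁻¹) ^ k * G x) :
    fderiv ℝ G x x = -k * G x := by
  have h1 : HasDerivAt (fun t : ℝ => G (t • x)) (fderiv ℝ G x x) 1 := by
    have e : HasDerivAt (fun t : ℝ => t • x) ((1 : ℝ) • x) 1 := (hasDerivAt_id 1).smul_const x
    have hG' : HasFDerivAt G (fderiv ℝ G x) ((1 : ℝ) • x) := by simpa using hG.hasFDerivAt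
    exact (hG'.comp_hasDerivAt 1 e).congr_deriv (by simp)
  have h2 : HasDerivAt (fun t : ℝ => (t⁻¹) ^ k * G x) (-k * G x) 1 := by
    have e := ((hasDerivAt_inv (one_ne_zero (α := ℝ))).pow k).mul_const (G x)
    refine e.congr_deriv ?_
    simp
  refine h1.unique (h2.congr_of_eventuallyEq ?_)
  filter_upwards [lt_mem_nhds (zero_lt_one (α := ℝ))] with t ht using hk t ht

lemma inner_gradient_eq (F : Space n → ℝ) (x v : Space n) :
    ⟪gradient F x, v⟫_ℝ = fderiv ℝ F x v := by
  rw [gradient, InnerProductSpace.toDual_symm_apply]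

lemma gradient_apply (F : Space n → ℝ) (x : Space n) (i : Fin n) :
    gradient F x i = pderiv i F x := by
  rw [pderiv, ← inner_gradient_eq, EuclideanSpace.inner_single_right]
  simp

lemma fderiv_pderiv_apply {F : Space n → ℝ} {x : Space n} (hF : ContDiffAt ℝ 2 F x) (i : Fin n)
    (v : Space n) : fderiv ℝ (pderiv i F) x v =
      fderiv ℝ (fderiv ℝ F) x v (EuclideanSpace.single i 1) := by
  have hd : DifferentiableAt ℝ (fderiv ℝ F) x :=
    (hF.fderiv_right (m := 1) (by norm_num)).differentiableAt one_ne_zero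
  have : HasFDerivAt (pderiv i F) _ x := hd.hasFDerivAt.clm_apply
    (hasFDerivAt_const (EuclideanSpace.single i (1 : ℝ)) x)
  rw [this.fderiv]
  simp

lemma hessMat_mulVec (F : Space n → ℝ) (x v : Space n) (i : Fin n) :
    (hessMat F x *ᵥ v.ofLp) i = fderiv ℝ (pderiv i F) x v := by
  rw [fderiv_apply_eq_sum]
  simp [mulVec, dotProduct, hessMat, mul_comm]

lemma hessMat_quadratic {F : Space n → ℝ} {x : Space n} (hF : ContDiffAt ℝ 2 F x) (v : Space n) :
    (hessMat F x *ᵥ v.ofLp) ⬝ᵥ v.ofLp = fderiv ℝ (fderiv ℝ F) x v v := by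
  have hL : ∀ L : Space n →L[ℝ] ℝ, L v = ∑ i, L (EuclideanSpace.single i 1) * v i := by
    intro L
    conv_lhs => rw [← (EuclideanSpace.basisFun (Fin n) ℝ).sum_repr v]
    simp [mul_comm]
  simp only [dotProduct, hessMat_mulVec, fderiv_pderiv_apply hF]
  rw [hL (fderiv ℝ (fderiv ℝ F) x v)]

lemma isSymm_hessMat {F : Space n → ℝ} {x : Space n} (hF : ContDiffAt ℝ 2 F x) :
    (hessMat F x).IsSymm := by
  ext i j
  have h := hF.isSymmSndFDerivAt (by simp)
  simp only [transpose_apply, hessMat, of_apply]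
  rw [pderiv, pderiv, fderiv_pderiv_apply hF, fderiv_pderiv_apply hF, h]

/-- The normal component of a chord is of second order. Hence a normal part of the gradient is
invisible at first order but interacts with the Hessian. -/
lemma inner_sub_self_sphere (θ θ' : Sphere n) :
    ⟪(θ : Space n), (θ' : Space n) - θ⟫_ℝ = -(1 / 2) * ‖(θ' : Space n) - θ‖ ^ 2 := by
  have h1 : ‖(θ : Space n)‖ = 1 := by simp
  have h2 : ‖(θ' : Space n)‖ = 1 := by simp
  rw [norm_sub_sq_real, inner_sub_right, real_inner_self_eq_norm_sq, h1, h2,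
    real_inner_comm (θ : Space n)]
  ring

lemma dotProduct_eq_inner (x y : Space n) : x.ofLp ⬝ᵥ y.ofLp = ⟪x, y⟫_ℝ := by
  rw [EuclideanSpace.inner_eq_star_dotProduct, dotProduct_comm]
  simp

lemma tendsto_coe_sphere (θ : Sphere n) :
    Filter.Tendsto (fun θ' : Sphere n => (θ' : Space n)) (𝓝 θ) (𝓝 (θ : Space n)) :=
  continuous_subtype_val.tendsto θ

variable [NeZero n] {f : Sphere n → ℝ}

/-- Euler's identity in degree zero. -/
lemma inner_gradient_self (hF : IsHomog fun x : Space n => f (dir x)) (θ : Sphere n) :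
    ⟪gradient (fun x : Space n => f (dir x)) θ, (θ : Space n)⟫_ℝ = 0 := by
  have h := ne_zero_of_mem_unit_sphere θ
  rw [inner_gradient_eq, fderiv_apply_self_of_homog
    ((hF.contDiffAt h).differentiableAt two_ne_zero) 0 fun t ht => by simpa using hF.smul ht θ]
  simp

lemma hasTaylorOne_gradient (hF : IsHomog fun x : Space n => f (dir x)) (θ : Sphere n) :
    HasTaylorOne f θ (gradient (fun x : Space n => f (dir x)) θ) := by
  have h := ne_zero_of_mem_unit_sphere θ
  have hd := ((hF.contDiffAt h).differentiableAt two_ne_zero).hasFDerivAt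
  have := ((hasFDerivAt_iff_isLittleO.1 hd).comp_tendsto (tendsto_coe_sphere θ)).norm_right
  refine this.congr (fun θ' => ?_) fun θ' => rfl
  simp

/-- A first-order expansion determines the vector up to multiples of `θ`. The gradient of the
extension is orthogonal to `θ`, so it is the unique shortest choice. -/
lemma sphericalGradient_eq (hF : IsHomog fun x : Space n => f (dir x)) (θ : Sphere n) :
    sphericalGradient f θ = gradient (fun x : Space n => f (dir x)) θ := by
  set w := gradient (fun x : Space n => f (dir x)) θ with hw
  have hT := hasTaylorOne_gradient hF θ
  have hwθ := inner_gradient_self hF θ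
  have hθ : ⟪(θ : Space n), (θ : Space n)⟫_ℝ = 1 := by simp
  have hdec : ∀ w', HasTaylorOne f θ w' → ∃ c : ℝ, w' = w + c • (θ : Space n) := by
    intro w' hw'
    have ho : (fun θ' : Sphere n => ⟪w' - w, (θ' : Space n) - θ⟫_ℝ) =o[𝓝 θ]
        fun θ' : Sphere n => ‖(θ' : Space n) - θ‖ ^ 1 := by
      refine (hT.sub hw').congr (fun θ' => ?_) fun θ' => by simp
      rw [inner_sub_left]
      ring
    have hz : ∀ v : Space n, ⟪(θ : Space n), v⟫_ℝ = 0 → ⟪w' - w, v⟫_ℝ = 0 := fun v hv =>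
      eq_zero_of_isLittleO_sphere θ 1 (by fun_prop)
        (fun t x => by rw [real_inner_smul_right, pow_one]) ho hv
    refine ⟨⟪(θ : Space n), w' - w⟫_ℝ, ?_⟩
    set r := w' - w - ⟪(θ : Space n), w' - w⟫_ℝ • (θ : Space n) with hr
    have hrθ : ⟪(θ : Space n), r⟫_ℝ = 0 := by
      rw [hr, inner_sub_right, real_inner_smul_right, hθ]; ring
    have : ⟪r, r⟫_ℝ = 0 := by
      conv_lhs => rw [hr, inner_sub_left, real_inner_smul_left, ← hr, hrθ, hz r hrθ]
      simp
    have hr0 : r = 0 := inner_self_eq_zero.1 this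
    rw [hr, sub_eq_zero] at hr0
    rw [← hr0]; abel
  have hnorm : ∀ c : ℝ, ‖w + c • (θ : Space n)‖ ^ 2 = ‖w‖ ^ 2 + c ^ 2 := by
    intro c
    have : ‖(θ : Space n)‖ = 1 := by simp
    rw [norm_add_sq_real, real_inner_smul_right, hwθ, norm_smul, this]
    simp
  have hgrad : IsSphericalGradient f θ w := by
    refine ⟨hT, fun w' hw' => ?_⟩
    obtain ⟨c, rfl⟩ := hdec w' hw'
    refine (sq_le_sq₀ (norm_nonneg _) (norm_nonneg _)).1 ?_
    rw [hnorm]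
    linarith [sq_nonneg c]
  have hex : ∃ w, IsSphericalGradient f θ w := ⟨w, hgrad⟩
  rw [sphericalGradient, dif_pos hex]
  have hs := hex.choose_spec
  obtain ⟨c, hc⟩ := hdec _ hs.1
  have h1 := hs.2 w hT
  rw [hc] at h1 ⊢
  have h2 := (sq_le_sq₀ (norm_nonneg _) (norm_nonneg _)).2 h1
  rw [hnorm] at h2
  have : c = 0 := by nlinarith [sq_nonneg c]
  simp [this]

/-- The spherical Hessian in terms of the second derivatives of the homogeneous extension. -/
noncomputable def tangentHessian (f : Sphere n → ℝ) (θ : Sphere n) : Matrix (Fin n) (Fin n) ℝ :=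
  hessMat (fun x : Space n => f (dir x)) θ +
    (vecMulVec (θ : Space n).ofLp (gradient (fun x : Space n => f (dir x)) θ).ofLp +
      vecMulVec (gradient (fun x : Space n => f (dir x)) θ).ofLp (θ : Space n).ofLp)

lemma isSymm_tangentHessian (hF : IsHomog fun x : Space n => f (dir x)) (θ : Sphere n) :
    (tangentHessian f θ).IsSymm := by
  refine (isSymm_hessMat (hF.contDiffAt (ne_zero_of_mem_unit_sphere θ))).add ?_
  rw [Matrix.IsSymm, transpose_add, transpose_vecMulVec, transpose_vecMulVec, add_comm]

/-- The partial derivatives are homogeneous of degree `-1`, so by Euler the Euclidean Hessian maps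
`θ` to minus the gradient; the rank-one terms cancel this. -/
lemma tangentHessian_mulVec_self (hF : IsHomog fun x : Space n => f (dir x)) (θ : Sphere n) :
    tangentHessian f θ *ᵥ (θ : Space n).ofLp = 0 := by
  have h := ne_zero_of_mem_unit_sphere θ
  have h1 : hessMat (fun x : Space n => f (dir x)) θ *ᵥ (θ : Space n).ofLp =
      -(gradient (fun x : Space n => f (dir x)) θ).ofLp := by
    ext i
    rw [hessMat_mulVec, fderiv_apply_self_of_homog (k := 1), Pi.neg_apply, gradient_apply]
    · simp
    · exact (contDiffAt_pderiv (m := 1) (hF.contDiffAt h) (by norm_num) i).differentiableAt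
        one_ne_zero
    · intro t ht
      rw [hF.pderiv_smul ht, pow_one]
  have h2 := inner_gradient_self hF θ
  have h3 : ⟪(θ : Space n), (θ : Space n)⟫_ℝ = 1 := by simp
  rw [tangentHessian, add_mulVec, add_mulVec, vecMulVec_mulVec, vecMulVec_mulVec, h1,
    dotProduct_eq_inner, dotProduct_eq_inner, h2, h3]
  simp

/-- Each rank-one term contains the normal component of the chord, so together they change the
quadratic form only at third order. -/
lemma tangentHessian_quadratic (hF : IsHomog fun x : Space n => f (dir x)) (θ θ' : Sphere n) :
    (tangentHessian f θ *ᵥ ((θ' : Space n) - θ).ofLp) ⬝ᵥ ((θ' : Space n) - θ).ofLp =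
      fderiv ℝ (fderiv ℝ fun x : Space n => f (dir x)) θ ((θ' : Space n) - θ)
          ((θ' : Space n) - θ) -
        fderiv ℝ (fun x : Space n => f (dir x)) θ ((θ' : Space n) - θ) *
          ‖(θ' : Space n) - θ‖ ^ 2 := by
  have h := ne_zero_of_mem_unit_sphere θ
  rw [tangentHessian, add_mulVec, add_mulVec, vecMulVec_mulVec, vecMulVec_mulVec, add_dotProduct,
    hessMat_quadratic (hF.contDiffAt h), op_smul_eq_smul, op_smul_eq_smul, add_dotProduct,
    smul_dotProduct, smul_dotProduct, smul_eq_mul, smul_eq_mul]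
  simp only [dotProduct_eq_inner, inner_gradient_eq, inner_sub_self_sphere]
  ring

lemma hasTaylorTwo_tangentHessian (hF : IsHomog fun x : Space n => f (dir x)) (θ : Sphere n) :
    HasTaylorTwo f θ (tangentHessian f θ) := by
  have h := ne_zero_of_mem_unit_sphere θ
  have h1 := (taylor_two_isLittleO (hF.contDiffAt h)).comp_tendsto (tendsto_coe_sphere θ)
  have h2 : (fun θ' : Sphere n => 1 / 2 * (fderiv ℝ (fun x : Space n => f (dir x)) θ
      ((θ' : Space n) - θ) * ‖(θ' : Space n) - θ‖ ^ 2)) =o[𝓝 θ]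
      fun θ' : Sphere n => ‖(θ' : Space n) - θ‖ ^ 2 := by
    have h3 : Filter.Tendsto (fun θ' : Sphere n => 1 / 2 * fderiv ℝ (fun x : Space n => f (dir x)) θ
        ((θ' : Space n) - θ)) (𝓝 θ) (𝓝 0) := by
      have : Continuous fun θ' : Sphere n => 1 / 2 * fderiv ℝ (fun x : Space n => f (dir x)) θ
        ((θ' : Space n) - θ) := by fun_prop
      simpa using this.tendsto θ
    have := ((isLittleO_one_iff ℝ).2 h3).mul_isBigO
      (isBigO_refl (fun θ' : Sphere n => ‖(θ' : Space n) - θ‖ ^ 2) (𝓝 θ))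
    refine this.congr (fun θ' => by ring) fun θ' => by ring
  refine (h1.add h2).congr (fun θ' => ?_) fun θ' => rfl
  rw [tangentHessian_quadratic hF, sphericalGradient_eq hF, inner_gradient_eq]
  simp only [Function.comp_apply, dir_coe]
  ring

/-- Any two second-order expansions differ by a symmetric form vanishing on tangent vectors. As
`tangentHessian` annihilates `θ`, it has the least norm (`hsNorm_le_hsNorm_add`). Equality of the
norms suffices, so uniqueness of the minimizer is not needed. -/
lemma hsNorm_sphericalHessian (hF : IsHomog fun x : Space n => f (dir x)) (θ : Sphere n) :
    hsNorm (sphericalHessian f θ) = hsNorm (tangentHessian f θ) := by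
  have hT := hasTaylorTwo_tangentHessian hF θ
  have hS := isSymm_tangentHessian hF θ
  have hmin : ∀ B : Matrix (Fin n) (Fin n) ℝ, B.IsSymm → HasTaylorTwo f θ B →
      hsNorm (tangentHessian f θ) ≤ hsNorm B := by
    intro B hB hBT
    have hD : (B - tangentHessian f θ).IsSymm := hB.sub hS
    have ho : (fun θ' : Sphere n => ((B - tangentHessian f θ) *ᵥ ((θ' : Space n) - θ).ofLp) ⬝ᵥ
        ((θ' : Space n) - θ).ofLp) =o[𝓝 θ] fun θ' : Sphere n => ‖(θ' : Space n) - θ‖ ^ 2 := by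
      refine ((hT.sub hBT).const_mul_left 2).congr (fun θ' => ?_) fun θ' => rfl
      rw [sub_mulVec, sub_dotProduct]
      ring
    have := hsNorm_le_hsNorm_add hS hD (θ := (θ : Space n).ofLp) (by rw [dotProduct_eq_inner]; simp)
      (tangentHessian_mulVec_self hF θ) fun v hv =>
        eq_zero_of_isLittleO_sphere θ (Q := fun v => ((B - tangentHessian f θ) *ᵥ v.ofLp) ⬝ᵥ v.ofLp)
          2 (by fun_prop)
          (fun t x => by
            simp only [WithLp.ofLp_smul, mulVec_smul, smul_dotProduct, dotProduct_smul, smul_eq_mul]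
            ring) ho (v := WithLp.toLp 2 v) (by rw [← dotProduct_eq_inner]; exact hv)
    simpa using this
  have hex : ∃ B, IsSphericalHessian f θ B := ⟨_, ⟨hS, hT⟩, hmin⟩
  rw [sphericalHessian, dif_pos hex]
  exact le_antisymm (hex.choose_spec.2 _ hS hT) (hmin _ hex.choose_spec.1.1 hex.choose_spec.1.2)

/-- The source of the gradient term: each of the two rank-one corrections has norm `|θ| |∇_S f| =
|∇_S f|`. -/
lemma hsNorm_hessMat_le (hF : IsHomog fun x : Space n => f (dir x)) (θ : Sphere n) :
    hsNorm (hessMat (fun x : Space n => f (dir x)) θ) ≤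
      hsNorm (sphericalHessian f θ) + 2 * ‖sphericalGradient f θ‖ := by
  rw [hsNorm_sphericalHessian hF, sphericalGradient_eq hF]
  set w := gradient (fun x : Space n => f (dir x)) θ
  have h1 : hessMat (fun x : Space n => f (dir x)) θ = tangentHessian f θ +
      (-1 : ℝ) • (vecMulVec (θ : Space n).ofLp w.ofLp + vecMulVec w.ofLp (θ : Space n).ofLp) := by
    simp only [tangentHessian, neg_smul, one_smul, add_neg_cancel_right, w]
  have h2 := hsNorm_add_le (vecMulVec (θ : Space n).ofLp w.ofLp)
    (vecMulVec w.ofLp (θ : Space n).ofLp)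
  have h3 : ‖(θ : Space n)‖ = 1 := by simp
  rw [hsNorm_vecMulVec, hsNorm_vecMulVec, h3] at h2
  rw [h1]
  refine (hsNorm_add_le _ _).trans ?_
  rw [hsNorm_smul]
  simp only [abs_neg, abs_one]
  linarith

lemma continuous_sphericalGradient (hF : IsHomog fun x : Space n => f (dir x)) :
    Continuous (sphericalGradient f) := by
  rw [show sphericalGradient f = _ from funext (sphericalGradient_eq hF)]
  rw [continuous_iff_continuousAt]
  intro θ
  have h1 : ContinuousAt (fderiv ℝ fun x : Space n => f (dir x)) θ :=
    ((hF.contDiffAt (ne_zero_of_mem_unit_sphere θ)).fderiv_right (m := 1)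
      (by norm_num)).continuousAt
  exact (InnerProductSpace.toDual ℝ (Space n)).symm.continuous.continuousAt.comp
    (h1.comp (f := fun θ : Sphere n => (θ : Space n)) continuous_subtype_val.continuousAt)

lemma continuous_hsNorm_sphericalHessian (hF : IsHomog fun x : Space n => f (dir x)) :
    Continuous fun θ => hsNorm (sphericalHessian f θ) := by
  simp only [hsNorm_sphericalHessian hF]
  have hg := continuous_sphericalGradient hF
  rw [show sphericalGradient f = _ from funext (sphericalGradient_eq hF)] at hg
  have hH : ∀ i j, Continuous fun θ : Sphere n =>
      hessMat (fun x : Space n => f (dir x)) θ i j := by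
    intro i j
    rw [continuous_iff_continuousAt]
    intro θ
    have := hF.contDiffAt (ne_zero_of_mem_unit_sphere θ)
    exact ContinuousAt.comp (f := fun θ : Sphere n => (θ : Space n))
      (contDiffAt_pderiv (m := 0) (k := 1) (contDiffAt_pderiv this (by norm_num) i)
        (by norm_num) j).continuousAt continuous_subtype_val.continuousAt
  unfold hsNorm tangentHessian
  simp only [Matrix.add_apply, vecMulVec_apply]
  fun_prop

end SphereCov

namespace SphereCov

variable {n : ℕ}

/-! ### The covariance inequality -/

section

variable [NeZero n] {f g : Sphere n → ℝ}

lemma cut_dir_smul {R : ℝ} (hR : 0 < R) (x : Space n) :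
    cut (fun x => f (dir x)) (R • x) =
      f (dir x) * Real.smoothTransition (2 * (R * ‖x‖) ^ 2 - 1) := by
  by_cases hx : x = 0
  · simp [hx, cut, cutoff, mul_comm]
  · rw [cut, cutoff, dir_smul hR hx, norm_smul, Real.norm_of_nonneg hR.le, mul_comm]

/-- Orthogonality to linear functions means that the extension has a gradient of zero mean. -/
lemma integral_pderiv_cut_eq_zero (hF : IsHomog fun x : Space n => f (dir x)) (hf : Measurable f)
    (hfl : OrthogonalToLinear f) {R : ℝ} (hR : 0 < R) (i : Fin n) :
    ∫ x, pderiv i (fun x => cut (fun x => f (dir x)) (R • x)) x ∂(gauss n) = 0 := by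
  -- By parts, the mean of the derivative is the mean of the function times `x_i`, which in polar
  -- coordinates is a radial integral times the integral of `f θ_i`.
  rw [← integral_mul_coord_gauss (hF.bddC1_cut_smul R) i]
  have hm : Measurable fun θ : Sphere n => f θ * (θ : Space n) i := by
    have : Measurable fun θ : Sphere n => (θ : Space n) i := Continuous.measurable (by fun_prop)
    fun_prop
  have hk : Measurable fun r : ℝ => Real.smoothTransition (2 * (R * r) ^ 2 - 1) * r := by
    have := (Real.smoothTransition.continuous).measurable
    fun_prop
  calc _ = ∫ x, f (dir x) * (dir x : Space n) i *
        (Real.smoothTransition (2 * (R * ‖x‖) ^ 2 - 1) * ‖x‖) ∂(gauss n) := by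
        congr 1
        ext x
        rw [cut_dir_smul hR]
        conv_lhs => rw [← norm_smul_dir x]
        rw [PiLp.smul_apply, smul_eq_mul, norm_smul_dir]
        ring
    _ = 0 := by
        rw [integral_gauss_polar hm hk]
        have : ∫ θ, f θ * (θ : Space n) i ∂(sigma n) = 0 :=
          hfl (EuclideanSpace.proj i : Space n →L[ℝ] ℝ).toLinearMap
        rw [this, zero_mul]

lemma integral_mul_cutoff_pow {a : Sphere n → ℝ} (ha : Measurable a) {R : ℝ} (k : ℕ) :
    ∫ x, a (dir x) * Real.smoothTransition (2 * (R * ‖x‖) ^ 2 - 1) ^ k ∂(gauss n) =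
      (∫ θ, a θ ∂(sigma n)) *
        ∫ x, Real.smoothTransition (2 * (R * ‖x‖) ^ 2 - 1) ^ k ∂(gauss n) := by
  have hk : Measurable fun r : ℝ => Real.smoothTransition (2 * (R * r) ^ 2 - 1) ^ k := by
    have := (Real.smoothTransition.continuous).measurable
    fun_prop
  exact integral_gauss_polar ha hk

lemma tendsto_integral_cutoff_pow (n : ℕ) [NeZero n] (k : ℕ) :
    Filter.Tendsto (fun N : ℕ => ∫ x, Real.smoothTransition
      (2 * (((N : ℝ) + 1) * ‖x‖) ^ 2 - 1) ^ k ∂(gauss n)) Filter.atTop (𝓝 1) := by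
  have h : Filter.Tendsto (fun N : ℕ => ∫ x, Real.smoothTransition
      (2 * (((N : ℝ) + 1) * ‖x‖) ^ 2 - 1) ^ k ∂(gauss n)) Filter.atTop
      (𝓝 (∫ _, (1 : ℝ) ∂(gauss n))) := by
    refine tendsto_integral_of_dominated_convergence (fun _ => 1) ?_ (integrable_const 1) ?_ ?_
    · intro N
      have := Real.smoothTransition.continuous
      exact Continuous.aestronglyMeasurable (by fun_prop)
    · refine fun N => .of_forall fun x => ?_
      rw [norm_pow, Real.norm_of_nonneg (Real.smoothTransition.nonneg _)]
      exact pow_le_one₀ (Real.smoothTransition.nonneg _) (Real.smoothTransition.le_one _)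
    · filter_upwards [ae_ne_zero_gauss n] with x hx
      refine tendsto_const_nhds.congr' ?_
      have hx0 := norm_pos_iff.2 hx
      filter_upwards [tendsto_one_div_add_atTop_nhds_zero_nat.eventually_lt_const hx0] with N hN
      rw [div_lt_iff₀ (by positivity)] at hN
      rw [Real.smoothTransition.one_of_one_le (by nlinarith), one_pow]
  simpa using h

/-- The sum over both indices is the expected Hilbert-Schmidt product of the two Hessians;
Cauchy-Schwarz for matrices reduces it to `lintegral_mul_rot_le`. -/
lemma abs_sum_cor_pderiv_le (hn : 5 ≤ n) {p q : ℝ≥0∞} [hpq : p.HolderConjugate q]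
    {F G : Space n → ℝ} (hF : IsHomog F) (hG : IsHomog G) {C : ℝ}
    (hFC : ∀ θ : Sphere n, hsNorm (hessMat F θ) ≤ C)
    (hGC : ∀ θ : Sphere n, hsNorm (hessMat G θ) ≤ C) {R : ℝ}
    (hFR : ∀ x, ‖hsNorm (hessMat (fun x => cut F (R • x)) x)‖ₑ ≤
      invSq x * (‖hsNorm (hessMat F (dir x))‖ₑ +
        ENNReal.ofReal C * {x : Space n | ‖x‖ ≤ 1 / R}.indicator 1 x))
    (hGR : ∀ x, ‖hsNorm (hessMat (fun x => cut G (R • x)) x)‖ₑ ≤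
      invSq x * (‖hsNorm (hessMat G (dir x))‖ₑ +
        ENNReal.ofReal C * {x : Space n | ‖x‖ ≤ 1 / R}.indicator 1 x)) (u : ℝ)
    (hfin : invFourth n * (eLpNorm (fun θ : Sphere n => hsNorm (hessMat F θ)) p (sigma n) *
        eLpNorm (fun θ : Sphere n => hsNorm (hessMat G θ)) q (sigma n)) +
        4 * ENNReal.ofReal C ^ 2 * smallBall n (1 / R) ≠ ⊤) :
    |∑ k, ∑ i, cor (pderiv i (pderiv k fun x => cut F (R • x)))
        (pderiv i (pderiv k fun x => cut G (R • x))) u| ≤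
      (invFourth n * (eLpNorm (fun θ : Sphere n => hsNorm (hessMat F θ)) p (sigma n) *
        eLpNorm (fun θ : Sphere n => hsNorm (hessMat G θ)) q (sigma n)) +
        4 * ENNReal.ofReal C ^ 2 * smallBall n (1 / R)).toReal := by
  set FR := fun x => cut F (R • x)
  set GR := fun x => cut G (R • x)
  have hbF : ∀ i, BddC1 (pderiv i FR) := fun i => hF.bddC1_pderiv_cut_smul R i
  have hbG : ∀ i, BddC1 (pderiv i GR) := fun i => hG.bddC1_pderiv_cut_smul R i
  have hint : ∀ k i, Integrable (fun z : Space n × Space n => pderiv i (pderiv k FR) z.1 *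
      pderiv i (pderiv k GR) (Real.cos u • z.1 + Real.sin u • z.2)) (gaussPair n) := by
    intro k i
    have h1 := (hbF k).continuous_pderiv i
    have h2 := (hbG k).continuous_pderiv i
    obtain ⟨C₁, hC₁⟩ := (hbF k).bdd_pderiv i
    obtain ⟨C₂, hC₂⟩ := (hbG k).bdd_pderiv i
    exact integrable_of_continuous_of_bdd (by fun_prop) ⟨C₁ * C₂, fun z => by
      rw [abs_mul]
      exact mul_le_mul (hC₁ _) (hC₂ _) (abs_nonneg _) ((abs_nonneg _).trans (hC₁ 0))⟩
  have hsum : ∑ k, ∑ i, cor (pderiv i (pderiv k FR)) (pderiv i (pderiv k GR)) u =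
      ∫ z, ∑ k, ∑ i, pderiv i (pderiv k FR) z.1 * pderiv i (pderiv k GR)
        (Real.cos u • z.1 + Real.sin u • z.2) ∂(gaussPair n) := by
    rw [integral_finsetSum _ fun k _ => integrable_finsetSum _ fun i _ => hint k i]
    refine Finset.sum_congr rfl fun k _ => ?_
    rw [integral_finsetSum _ fun i _ => hint k i]
    rfl
  have hbd := lintegral_mul_rot_le hn u (p := p) (q := q)
    hF.continuous_hsNorm_hessMat_coe.measurable hG.continuous_hsNorm_hessMat_coe.measurable
    (C := ENNReal.ofReal C) (fun θ => by
      rw [Real.enorm_of_nonneg (hsNorm_nonneg _)]; exact ENNReal.ofReal_le_ofReal (hFC θ))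
    (fun θ => by
      rw [Real.enorm_of_nonneg (hsNorm_nonneg _)]; exact ENNReal.ofReal_le_ofReal (hGC θ)) hFR hGR
  rw [hsum, ← Real.norm_eq_abs, ← toReal_enorm]
  refine ENNReal.toReal_mono hfin ((enorm_integral_le_lintegral_enorm _).trans
    ((lintegral_mono fun z => ?_).trans hbd))
  rw [← enorm_mul]
  rw [Real.enorm_eq_ofReal_abs, Real.enorm_of_nonneg
    (mul_nonneg (hsNorm_nonneg _) (hsNorm_nonneg _))]
  exact ENNReal.ofReal_le_ofReal
    (abs_sum_mul_le_hsNorm (hessMat FR z.1) (hessMat GR (rot n u z).1))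

/-- The covariance inequality in terms of the homogeneous extensions. -/
lemma abs_integral_mul_sub_le (hn : 5 ≤ n) {p q : ℝ≥0∞} [hpq : p.HolderConjugate q]
    (hfc : Continuous f) (hgc : Continuous g) (hF : IsHomog fun x : Space n => f (dir x))
    (hG : IsHomog fun x : Space n => g (dir x))
    (hfl : OrthogonalToLinear f) :
    |∫ θ, f θ * g θ ∂(sigma n) - (∫ θ, f θ ∂(sigma n)) * ∫ θ, g θ ∂(sigma n)| ≤
      1 / (((n : ℝ) - 2) * ((n : ℝ) - 4)) *
        (eLpNorm (fun θ : Sphere n => hsNorm (hessMat (fun x => f (dir x)) θ)) p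
            (sigma n)).toReal *
        (eLpNorm (fun θ : Sphere n => hsNorm (hessMat (fun x => g (dir x)) θ)) q
            (sigma n)).toReal := by
  obtain ⟨C₁, hC₁, hFR⟩ := hF.exists_hsNorm_hessMat_cut_le
  obtain ⟨C₂, hC₂, hGR⟩ := hG.exists_hsNorm_hessMat_cut_le
  set F : Space n → ℝ := fun x => f (dir x)
  set G : Space n → ℝ := fun x => g (dir x)
  set C := max C₁ C₂
  set a := eLpNorm (fun θ : Sphere n => hsNorm (hessMat F θ)) p (sigma n)
  set b := eLpNorm (fun θ : Sphere n => hsNorm (hessMat G θ)) q (sigma n)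
  have ha : a ≠ ⊤ := (MemLp.of_bound hF.continuous_hsNorm_hessMat_coe.aestronglyMeasurable C₁
    (.of_forall fun θ => by
      rw [Real.norm_of_nonneg (hsNorm_nonneg _)]; exact hC₁ θ)).eLpNorm_ne_top
  have hb : b ≠ ⊤ := (MemLp.of_bound hG.continuous_hsNorm_hessMat_coe.aestronglyMeasurable C₂
    (.of_forall fun θ => by
      rw [Real.norm_of_nonneg (hsNorm_nonneg _)]; exact hC₂ θ)).eLpNorm_ne_top
  set M : ℕ → ℝ≥0∞ := fun N => invFourth n * (a * b) +
    4 * ENNReal.ofReal C ^ 2 * smallBall n (1 / ((N : ℝ) + 1)) with hM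
  have hM0 : invFourth n * (a * b) ≠ ⊤ :=
    ENNReal.mul_ne_top ENNReal.ofReal_ne_top (ENNReal.mul_ne_top ha hb)
  have hMlim : Filter.Tendsto M Filter.atTop (𝓝 (invFourth n * (a * b))) := by
    have h := ENNReal.Tendsto.const_mul (a := 4 * ENNReal.ofReal C ^ 2) (tendsto_smallBall hn)
      (Or.inr (by finiteness))
    have h' := h.const_add (invFourth n * (a * b))
    rwa [mul_zero, add_zero] at h'
  have hMlim' := (ENNReal.tendsto_toReal hM0).comp hMlim
  -- The means carry one factor of the cut-off and the product `F G` carries two, hence the powers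
  -- `1` and `2`; both integrals tend to one.
  set e : ℕ → ℕ → ℝ := fun k N => ∫ x, Real.smoothTransition
      (2 * (((N : ℝ) + 1) * ‖x‖) ^ 2 - 1) ^ k ∂(gauss n) with he
  have hcov : Filter.Tendsto (fun N => |(∫ θ, f θ * g θ ∂(sigma n)) * e 2 N -
      ((∫ θ, f θ ∂(sigma n)) * e 1 N) * ((∫ θ, g θ ∂(sigma n)) * e 1 N)|) Filter.atTop
      (𝓝 |∫ θ, f θ * g θ ∂(sigma n) - (∫ θ, f θ ∂(sigma n)) * ∫ θ, g θ ∂(sigma n)|) := by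
    have h1 := tendsto_integral_cutoff_pow n 1
    have h2 := tendsto_integral_cutoff_pow n 2
    have := ((h2.const_mul (∫ θ, f θ * g θ ∂(sigma n))).sub
      ((h1.const_mul (∫ θ, f θ ∂(sigma n))).mul (h1.const_mul (∫ θ, g θ ∂(sigma n))))).abs
    simpa only [mul_one] using this
  have hfinal : |∫ θ, f θ * g θ ∂(sigma n) - (∫ θ, f θ ∂(sigma n)) * ∫ θ, g θ ∂(sigma n)| ≤
      (invFourth n * (a * b)).toReal := by
    refine le_of_tendsto_of_tendsto hcov hMlim' ?_
    -- `toReal` sends `⊤` to zero, so the bound is usable only where `M N` is finite, which holds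
    -- for large `N`.
    have hMev : ∀ᶠ N in Filter.atTop, M N ≠ ⊤ :=
      (hMlim.eventually_lt_const hM0.lt_top).mono fun N hN => hN.ne
    filter_upwards [hMev] with N hN
    set R : ℝ := (N : ℝ) + 1
    have hR : 0 < R := by positivity
    set FR := fun x => cut F (R • x) with hFRdef
    set GR := fun x => cut G (R • x) with hGRdef
    have hind : ∀ D, D ≤ C → ∀ x : Space n, ∀ v : ℝ≥0∞,
        invSq x * (v + ENNReal.ofReal D * {x : Space n | ‖x‖ ≤ 1 / R}.indicator 1 x) ≤
        invSq x * (v + ENNReal.ofReal C * {x : Space n | ‖x‖ ≤ 1 / R}.indicator 1 x) := by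
      intro D hD x v
      gcongr
    have h2 := fun u => abs_sum_cor_pderiv_le hn (p := p) (q := q) hF hG (C := C) (R := R)
      (fun θ => (hC₁ θ).trans (le_max_left _ _)) (fun θ => (hC₂ θ).trans (le_max_right _ _))
      (fun x => (hFR R hR x).trans (hind _ (le_max_left _ _) x _))
      (fun x => (hGR R hR x).trans (hind _ (le_max_right _ _) x _)) u hN
    -- Interpolation for the gradients: their means vanish, so the correlations themselves are
    -- bounded by those of the second derivatives.
    have h1 : ∀ s ∈ Set.Icc 0 (Real.pi / 2),
        |∑ _ : Unit, ∑ k, cor (pderiv k FR) (pderiv k GR) s| ≤ (M N).toReal := by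
      intro s hs
      have := abs_sum_cor_sub_le (F := fun k => pderiv k FR) (G := fun k => pderiv k GR)
        (fun k => hF.bddC1_pderiv_cut_smul R k)
        (fun k => hG.bddC1_pderiv_cut_smul R k) (fun u _ => h2 u) hs
      have hz : ∀ k, ∫ x, pderiv k FR x ∂(gauss n) = 0 := fun k =>
        integral_pderiv_cut_eq_zero hF hfc.measurable hfl hR k
      simp only [hz, zero_mul, Finset.sum_const_zero, sub_zero] at this
      rwa [Finset.univ_unique, Finset.sum_singleton]
    -- Interpolation for the functions, evaluated at `s = 0`, where the correlation is the mean of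
    -- the product.
    have h0 := abs_sum_cor_sub_le (ι := Unit) (F := fun _ => FR) (G := fun _ => GR)
      (fun _ => hF.bddC1_cut_smul R) (fun _ => hG.bddC1_cut_smul R) h1
      (s := 0) ⟨le_rfl, by positivity⟩
    have hFRc := (hF.bddC1_cut_smul R).continuous
    have hGRc := (hG.bddC1_cut_smul R).continuous
    simp only [Finset.univ_unique, Finset.sum_singleton] at h0
    rw [cor_zero _ _ (by fun_prop)] at h0
    have e1 : ∫ x, FR x * GR x ∂(gauss n) = (∫ θ, f θ * g θ ∂(sigma n)) * e 2 N := by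
      rw [he, ← integral_mul_cutoff_pow (a := fun θ => f θ * g θ)
        (hfc.measurable.mul hgc.measurable)]
      congr 1
      ext x
      simp only [hFRdef, hGRdef, F, G, cut_dir_smul hR]
      ring
    have e2 : ∫ x, FR x ∂(gauss n) = (∫ θ, f θ ∂(sigma n)) * e 1 N := by
      rw [he, ← integral_mul_cutoff_pow hfc.measurable]
      simp only [hFRdef, F, cut_dir_smul hR, pow_one]
      rfl
    have e3 : ∫ x, GR x ∂(gauss n) = (∫ θ, g θ ∂(sigma n)) * e 1 N := by
      rw [he, ← integral_mul_cutoff_pow hgc.measurable]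
      simp only [hGRdef, G, cut_dir_smul hR, pow_one]
      rfl
    rw [e1, e2, e3] at h0
    exact h0
  refine hfinal.trans_eq ?_
  have hn' : (5 : ℝ) ≤ n := by exact_mod_cast hn
  have : 0 < ((n : ℝ) - 2) * ((n : ℝ) - 4) := mul_pos (by linarith) (by linarith)
  rw [ENNReal.toReal_mul, ENNReal.toReal_mul, invFourth, ENNReal.toReal_ofReal (by positivity),
    mul_assoc]

/-- Minkowski's inequality applied to `hsNorm_hessMat_le`; continuity on the compact sphere keeps
all norms finite, so they can be compared as real numbers. -/
lemma eLpNorm_hsNorm_hessMat_le {p : ℝ≥0∞} (hp : 1 ≤ p)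
    (hF : IsHomog fun x : Space n => f (dir x)) :
    (eLpNorm (fun θ : Sphere n => hsNorm (hessMat (fun x => f (dir x)) θ)) p (sigma n)).toReal ≤
      hessNorm f p + 2 * gradNorm f p := by
  have hgc := continuous_sphericalGradient hF
  have hhc := continuous_hsNorm_sphericalHessian hF
  have hg : MemLp (fun θ => sphericalGradient f θ) p (sigma n) := by
    obtain ⟨C, hC⟩ := (isCompact_univ (X := Sphere n)).exists_bound_of_continuousOn hgc.continuousOn
    exact MemLp.of_bound hgc.aestronglyMeasurable C (.of_forall fun θ => hC θ (Set.mem_univ _))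
  have hh : MemLp (fun θ => hsNorm (sphericalHessian f θ)) p (sigma n) := by
    obtain ⟨C, hC⟩ := (isCompact_univ (X := Sphere n)).exists_bound_of_continuousOn hhc.continuousOn
    exact MemLp.of_bound hhc.aestronglyMeasurable C (.of_forall fun θ => hC θ (Set.mem_univ _))
  have h1 : eLpNorm (fun θ : Sphere n => hsNorm (hessMat (fun x => f (dir x)) θ)) p (sigma n) ≤
      eLpNorm (fun θ => hsNorm (sphericalHessian f θ)) p (sigma n) +
        2 * eLpNorm (fun θ => sphericalGradient f θ) p (sigma n) := by
    calc _ ≤ eLpNorm ((fun θ => hsNorm (sphericalHessian f θ)) +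
          (2 : ℝ) • fun θ => ‖sphericalGradient f θ‖) p (sigma n) := by
          refine eLpNorm_mono_real fun θ => ?_
          rw [Real.norm_of_nonneg (hsNorm_nonneg _)]
          exact hsNorm_hessMat_le hF θ
      _ ≤ _ := by
          refine (eLpNorm_add_le hh.1 (hg.1.norm.const_smul 2) hp).trans ?_
          rw [eLpNorm_const_smul, eLpNorm_norm]
          simp [enorm]
  refine (ENNReal.toReal_mono ?_ h1).trans ?_
  · have := hg.eLpNorm_ne_top
    have := hh.eLpNorm_ne_top
    finiteness
  · rw [ENNReal.toReal_add hh.eLpNorm_ne_top (by have := hg.eLpNorm_ne_top; finiteness),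
      ENNReal.toReal_mul]
    rfl

end

end SphereCov

theorem corollary14p1 (n : ℕ) (hn : 5 ≤ n) (p q : ℝ≥0∞) (hp : 1 ≤ p) (hq : 1 ≤ q)
    (hpq : 1 / p + 1 / q = 1) (f g : SphereCov.Sphere n → ℝ)
    (hf : SphereCov.IsC2 f) (hg : SphereCov.IsC2 g)
    (hfl : SphereCov.OrthogonalToLinear f) (hgl : SphereCov.OrthogonalToLinear g) :
    |cov[f, g; SphereCov.sigma n]| ≤
      1 / (((n : ℝ) - 2) * ((n : ℝ) - 4)) *
        (SphereCov.hessNorm f p + 2 * SphereCov.gradNorm f p) *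
        (SphereCov.hessNorm g q + 2 * SphereCov.gradNorm g q) := by
  have : NeZero n := ⟨by omega⟩
  have : p.HolderConjugate q := ⟨by simpa [one_div] using hpq⟩
  have hL2 : ∀ h : SphereCov.Sphere n → ℝ, Continuous h → MemLp h 2 (SphereCov.sigma n) := by
    intro h hc
    obtain ⟨C, hC⟩ :=
      (isCompact_univ (X := SphereCov.Sphere n)).exists_bound_of_continuousOn hc.continuousOn
    exact MemLp.of_bound hc.aestronglyMeasurable C (.of_forall fun θ => hC θ (Set.mem_univ _))
  rw [covariance_eq_sub (hL2 f hf.continuous) (hL2 g hg.continuous)]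
  have hn' : (5 : ℝ) ≤ n := by exact_mod_cast hn
  have hpos : 0 < ((n : ℝ) - 2) * ((n : ℝ) - 4) := mul_pos (by linarith) (by linarith)
  refine (SphereCov.abs_integral_mul_sub_le hn (p := p) (q := q) hf.continuous hg.continuous
    hf.isHomog hg.isHomog hfl).trans ?_
  have h1 := SphereCov.eLpNorm_hsNorm_hessMat_le hp hf.isHomog
  have h2 := SphereCov.eLpNorm_hsNorm_hessMat_le hq hg.isHomog
  have h0 : 0 ≤ SphereCov.hessNorm f p + 2 * SphereCov.gradNorm f p :=
    ENNReal.toReal_nonneg.trans h1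
  gcongr
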